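/- **Setting.** Let $n\ge 1$ and let $H=\sum_{j=0}^{n-1}H_{j,j+1}$ be a nearest-neighbour lattice Hamiltonian: each $H_{j,j+1}$ is a Hermitian operator on a system of qubits that acts only on the sites $j$ and $j+1$ of a chain, which is either open, with sites $0,\dots,n$, or closed, with $n$ sites, $n$ even and site $n$ identified with site $0$. Put $A=\sum_{j\ \mathrm{even}}H_{j,j+1}$, $B=\sum_{j\ \mathrm{odd}}H_{j,j+1}$. Let $\|\cdot\|$ be the spectral norm and let $\|M\|_1=\sum_P|c_P|$ be the $\ell^1$-norm of the coefficients in the expansion $M=\sum_P c_PP$ in Pauli strings. Put $\Lambda=\max_j\|H_{j,j+1}\|$ and $\Lambda_1=\max_j\|H_{j,j+1}\|_1$. Let $K=1$ or $K=2k$ with $k\ge1$. The $K$th-order Trotter formula is $S_1(x)=e^{-ixB}e^{-ixA}$, $S_2(x)=e^{-ixA/2}e^{-ixB}e^{-ixA/2}$ and, for $k\ge2$, $S_{2k}(x)=S_{2k-2}(u_kx)^2\,S_{2k-2}((1-4u_k)x)\,S_{2k-2}(u_kx)^2$ with $u_k=1/(4-4^{1/(2k-1)})$. Let $\kappa$ be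 a stage number of this formula: there are real $a_1,b_1,\dots,a_\kappa,b_\kappa$ such that $S_K(x)=W_\kappa(x)\cdots W_1(x)$, $W_j(x)=e^{-ixb_jB}e^{-ixa_jA}$, holds identically in the operators $A,B$ and in $x$ (for example $\kappa=1$ for $K=1$, and $\kappa=2\cdot5^{k-1}$ for $K=2k$). Put $\beta=2(4\kappa+5)$. Let $U(x)=e^{-ixH}$, $V_K(x)=U(x)S_K(x)^\dagger$, $J_K(x)=S_K(x)\bigl(\tfrac{d}{dx}S_K(x)^\dagger-iHS_K(x)^\dagger\bigr)$ and $C_s=J_K^{(s)}(0)$. For $K+1\le s\le 2K+1$ let $F_s(x)=C_{s-1}x^s/s!$ and $\eta_s=\|C_{s-1}\|_1x^s/s!$; let $\eta_\Sigma=\sum_{s=K+1}^{2K+1}\eta_s$ and $\tilde V_K^{(nc)}(x)=I+\sum_{s=K+1}^{2K+1}F_s(x)$. Write the Pauli expansion of the anti-Hermitian operator $C_s$ as $C_s=i\|C_s\|_1\sum_\gamma\Pr(\gamma|s)P(s,\gamma)$, with $\Pr(\cdot|s)$ a probability distribution (when $C_s\ne0$) and $P(s,\gamma)$ Pauli strings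 with sign $\pm1$. A $(\mu,\varepsilon)$-LCU formula of an operator $V$ consists of $\mu>0$, a finite probability distribution $(p_i)$ and unitaries $V_i$ with $\|V-\mu\sum_ip_iV_i\|\le\varepsilon$. **Proposition.** Let $0<x<\min\{\frac{K+1}{\beta\Lambda},\frac{K+2}{\beta\Lambda_1}\}$ (any $x>0$ if $H_{j,j+1}=0$ for all $j$). Put $\mu_K=\sqrt{1+\eta_\Sigma^2}$ and $\varepsilon_K=\|\tilde V_K^{(nc)}(x)-V_K(x)\|$. Then $$\tilde V_K^{(nc)}(x)=\mu_K\sum_{s=K+1}^{2K+1}\frac{\eta_s}{\eta_\Sigma}\sum_\gamma\Pr(\gamma|s-1)\,e^{\,i\arctan(\eta_\Sigma)P(s-1,\gamma)}$$ (if $\eta_\Sigma=0$, the right-hand side is read as $I$, with the uniform distribution on the indices $(s,\gamma)$), and this is a $(\mu_K,\varepsilon_K)$-LCU formula of $V_K(x)$ with $$\mu_K\le\exp\!\Bigl(\frac{n^2\kappa^2\beta^{2K+2}}{2(K!)^2}(\Lambda_1x)^{2K+2}\Bigr),\qquad \varepsilon_K\le(n\kappa)^2\frac{\beta^{2K+1}}{K!\,(K+1)!}(\Lambda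 x)^{2K+2}.$$ Consequently, multiplying each unitary on the right by $S_K(x)$ gives a $(\mu_K,\varepsilon_K)$-LCU formula $\tilde V_K^{(nc)}(x)S_K(x)$ of $U(x)$. -/

import Mathlib

open scoped Matrix Matrix.Norms.L2Operator

noncomputable section

namespace TrotterLCU

/-! ### Qubits, Pauli strings and the Pauli 1-norm -/

/-- Labels of the computational basis of `N` qubits. -/
abbrev Qubits (N : ℕ) : Type := Fin N → Fin 2

/-- Operators on `N` qubits. The norm on them is the spectral norm
(the instance opened from `Matrix.Norms.L2Operator`). -/
abbrev Op (N : ℕ) : Type := Matrix (Qubits N) (Qubits N) ℂ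

/-- The single-qubit Pauli matrices `I, X, Y, Z`. -/
def pauli : Fin 4 → Matrix (Fin 2) (Fin 2) ℂ :=
  ![!![1, 0; 0, 1], !![0, 1; 1, 0], !![0, -Complex.I; Complex.I, 0], !![1, 0; 0, -1]]

/-- Labels of the `4 ^ N` Pauli strings on `N` qubits. -/
abbrev PauliString (N : ℕ) : Type := Fin N → Fin 4

/-- The `N`-qubit Pauli operator `P₀ ⊗ ⋯ ⊗ P_{N-1}`. -/
def pauliOp {N : ℕ} (p : PauliString N) : Op N :=
  Matrix.of fun s t => ∏ j, pauli (p j) (s j) (t j)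

/-- The coefficient `Tr (P M) / 2 ^ N` of the Pauli operator `P` in the expansion `M = ∑ c_P P`. -/
def pauliCoeff {N : ℕ} (M : Op N) (p : PauliString N) : ℂ :=
  (pauliOp p * M).trace / 2 ^ N

/-- The 1-norm of an operator: the `ℓ¹`-norm of the coefficients of its Pauli expansion. -/
def pauliNorm {N : ℕ} (M : Op N) : ℝ :=
  ∑ p : PauliString N, ‖pauliCoeff M p‖

open Classical in
/-- `M` acts on the set `S` of qubits only, that is `M = T ⊗ 1` with `T` an operator on the
qubits in `S`. -/
def ActsOn {N : ℕ} (S : Set (Fin N)) (M : Op N) : Prop :=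
  ∃ T : Matrix (S → Fin 2) (S → Fin 2) ℂ, ∀ s t : Qubits N,
    M s t = if ∀ v, v ∉ S → s v = t v then T (fun v => s v) (fun v => t v) else 0

/-! ### Lattice Hamiltonians -/

/-- The two sites `j` and `j + 1` of a chain with `N` sites `0, …, N - 1`; the site `N` is `0`. -/
def bond (N j : ℕ) : Set (Fin N) :=
  {v | (v : ℕ) = j ∨ (v : ℕ) = (j + 1) % N}

/-- A nearest-neighbour lattice Hamiltonian `H = ∑_{j < n} H_{j,j+1}` on `N` qubits. The sites form
either an open chain, with the `n + 1` sites `0, …, n`, or a closed chain of `n` sites with `n`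
even, so that in both cases the `H_{j,j+1}` with `j` of one parity act on disjoint pairs. -/
structure LatticeHamiltonian (n N : ℕ) where
  geometry : N = n + 1 ∨ (N = n ∧ Even n)
  term : Fin n → Op N
  isHermitian : ∀ j, (term j).IsHermitian
  actsOn : ∀ j : Fin n, ActsOn (bond N j) (term j)

namespace LatticeHamiltonian

variable {n N : ℕ} (h : LatticeHamiltonian n N)

/-- `A`, the sum of the `H_{j,j+1}` with `j` even. -/
def A : Op N := ∑ j ∈ Finset.univ.filter (fun j : Fin n => Even (j : ℕ)), h.term j

/-- `B`, the sum of the `H_{j,j+1}` with `j` odd. -/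
def B : Op N := ∑ j ∈ Finset.univ.filter (fun j : Fin n => Odd (j : ℕ)), h.term j

/-- The Hamiltonian. -/
def H : Op N := ∑ j : Fin n, h.term j

/-- `Λ`, the largest spectral norm of a summand. -/
def Lam : ℝ := ⨆ j : Fin n, ‖h.term j‖

/-- `Λ₁`, the largest 1-norm of a summand. -/
def Lam1 : ℝ := ⨆ j : Fin n, pauliNorm (h.term j)

end LatticeHamiltonian

/-! ### Time evolution and Trotter formulas -/

section Trotter

variable {m : Type} [Fintype m] [DecidableEq m]

/-- `exp (-i x H)`. -/
def evol (H : Matrix m m ℂ) (x : ℝ) : Matrix m m ℂ :=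
  NormedSpace.exp ((-(Complex.I * (x : ℂ))) • H)

/-- `u_k = 1 / (4 - 4 ^ (1 / (2 k - 1)))`. -/
def suzukiCoeff (k : ℕ) : ℝ := 1 / (4 - (4 : ℝ) ^ (1 / (2 * (k : ℝ) - 1)))

/-- The Trotter formula `S_{2k}(x)` for `H = A + B`:
`S_2(x) = e^{-ixA/2} e^{-ixB} e^{-ixA/2}` and, for `k ≥ 2`,
`S_{2k}(x) = S_{2k-2}(u_k x)² S_{2k-2}((1 - 4 u_k) x) S_{2k-2}(u_k x)²`. -/
def suzuki (A B : Matrix m m ℂ) : ℕ → ℝ → Matrix m m ℂ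
  | 0, _ => 1
  | 1, x => evol A (x / 2) * evol B x * evol A (x / 2)
  | k + 2, x =>
      suzuki A B (k + 1) (suzukiCoeff (k + 2) * x) ^ 2 *
        suzuki A B (k + 1) ((1 - 4 * suzukiCoeff (k + 2)) * x) *
        suzuki A B (k + 1) (suzukiCoeff (k + 2) * x) ^ 2

/-- The `K`th-order Trotter formula `S_K(x)` for `H = A + B`, with `K = 1` or `K` even. -/
def trotter (A B : Matrix m m ℂ) (K : ℕ) (x : ℝ) : Matrix m m ℂ :=
  if K = 1 then evol B x * evol A x else suzuki A B (K / 2) x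

/-- The product `W_κ(x) ⋯ W_2(x) W_1(x)` of the `κ` stages `W_j(x) = e^{-i x b_j B} e^{-i x a_j A}`
(the index `j` runs over `0, …, κ - 1` here). -/
def stageProduct (A B : Matrix m m ℂ) {κ : ℕ} (a b : Fin κ → ℝ) (x : ℝ) : Matrix m m ℂ :=
  (List.ofFn fun j : Fin κ => evol B (b j * x) * evol A (a j * x)).reverse.prod

end Trotter

/-- The stage lengths `a`, `b` write the `K`th-order Trotter formula as a product of `κ` stages,
identically in the two operators and in the time. -/
def IsStageForm (K : ℕ) {κ : ℕ} (a b : Fin κ → ℝ) : Prop :=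
  ∀ (d : ℕ) (A B : Matrix (Fin d) (Fin d) ℂ) (x : ℝ), trotter A B K x = stageProduct A B a b x

/-! ### LCU formulas -/

/-- The probabilities `p` and the unitaries `W` give the `(μ, ε)`-LCU formula `μ ∑ p_i W_i`
of the operator `V`. -/
structure IsLCUFormula {m ι : Type} [Fintype m] [DecidableEq m] [Fintype ι]
    (μ ε : ℝ) (p : ι → ℝ) (W : ι → Matrix m m ℂ) (V : Matrix m m ℂ) : Prop where
  mu_pos : 0 < μ
  prob_nonneg : ∀ i, 0 ≤ p i
  prob_sum : ∑ i, p i = 1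
  unitary : ∀ i, W i ∈ Matrix.unitaryGroup m ℂ
  dist_le : ‖V - (μ : ℂ) • ∑ i, (p i : ℂ) • W i‖ ≤ ε

/-! ### The paired nested-commutator formula -/

namespace LatticeHamiltonian

variable {n N : ℕ} (h : LatticeHamiltonian n N) (K : ℕ)

/-- `S_K(x)`. -/
def S (x : ℝ) : Op N := trotter h.A h.B K x

/-- `U(x) = exp (-i x H)`. -/
def U (x : ℝ) : Op N := evol h.H x

/-- The Trotter remainder `V_K(x) = U(x) S_K(x)†`. -/
def V (x : ℝ) : Op N := h.U x * (h.S K x)ᴴ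

/-- `R_K(x) = d/dx S_K(x)† - i H S_K(x)†`. -/
def R (x : ℝ) : Op N :=
  deriv (fun y : ℝ => (h.S K y)ᴴ) x - Complex.I • (h.H * (h.S K x)ᴴ)

/-- `J_K(x) = S_K(x) R_K(x)`. -/
def J (x : ℝ) : Op N := h.S K x * h.R K x

/-- `C_s = J_K^{(s)}(0)`. -/
def C (s : ℕ) : Op N := iteratedDeriv s (h.J K) 0

/-- `F_{K,s}(x) = C_{s-1} x^s / s!`. -/
def F (s : ℕ) (x : ℝ) : Op N := ((x ^ s / (s.factorial : ℝ) : ℝ) : ℂ) • h.C K (s - 1)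

/-- `Ṽ_K(x) = I + ∑_{s=K+1}^{2K+1} F_{K,s}(x)`. -/
def Vtilde (x : ℝ) : Op N := 1 + ∑ s ∈ Finset.Icc (K + 1) (2 * K + 1), h.F K s x

/-- `η_s = ‖C_{s-1}‖₁ x^s / s!`. -/
def eta (s : ℕ) (x : ℝ) : ℝ := pauliNorm (h.C K (s - 1)) * (x ^ s / (s.factorial : ℝ))

/-- `η_Σ = ∑_{s=K+1}^{2K+1} η_s`. -/
def etaSum (x : ℝ) : ℝ := ∑ s ∈ Finset.Icc (K + 1) (2 * K + 1), h.eta K s x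

/-- `μ_K(x) = √(1 + η_Σ²)`. -/
def mu (x : ℝ) : ℝ := √(1 + h.etaSum K x ^ 2)

/-- `ε_K(x) = ‖Ṽ_K(x) - V_K(x)‖`. -/
def eps (x : ℝ) : ℝ := ‖h.Vtilde K x - h.V K x‖

/-- The real coefficient `r` of `i P` in the Pauli expansion `C_s = i ∑ r_P P` of the
anti-Hermitian operator `C_s`. -/
def coeffC (s : ℕ) (p : PauliString N) : ℝ := (pauliCoeff (h.C K s) p).im

/-- `Pr(γ | s) = |r_γ| / ‖C_s‖₁`. -/
def probC (s : ℕ) (p : PauliString N) : ℝ := |h.coeffC K s p| / pauliNorm (h.C K s)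

/-- The signed Pauli operator `P(s, γ)`, so that `C_s = i ‖C_s‖₁ ∑_γ Pr(γ | s) P(s, γ)`. -/
def signedPauli (s : ℕ) (p : PauliString N) : Op N :=
  if 0 ≤ h.coeffC K s p then pauliOp p else -pauliOp p

/-- The indices `(s, γ)`, with `K + 1 ≤ s ≤ 2K + 1`, of the paired formula. -/
abbrev PairIndex (N K : ℕ) : Type :=
  ↥(Finset.Icc (K + 1) (2 * K + 1)) × PauliString N

/-- The probability `(η_s / η_Σ) Pr(γ | s-1)` of the index `(s, γ)`. If `η_Σ = 0` then all the
unitaries of the formula are `I` and the choice of the distribution is immaterial: take the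
uniform one. -/
def pairedProb (x : ℝ) (i : PairIndex N K) : ℝ :=
  if h.etaSum K x = 0 then 1 / (Fintype.card (PairIndex N K) : ℝ)
  else h.eta K i.1 x / h.etaSum K x * h.probC K (i.1 - 1) i.2

/-- The Pauli rotation `exp (i θ(η_Σ) P(s-1, γ))` with `θ = arctan`. -/
def pairedUnitary (x : ℝ) (i : PairIndex N K) : Op N :=
  NormedSpace.exp ((Complex.I * (Real.arctan (h.etaSum K x) : ℂ)) • h.signedPauli K (i.1 - 1) i.2)

end LatticeHamiltonian

end TrotterLCU

end

/-!
The remainder satisfies `V' = V J` with `V 0 = 1` and `J = O(x ^ K)`. Hence replacing `V` by `1` in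
the integral of `V J` costs only `O(x ^ (2 K + 2))`, and `Ṽ` is the Taylor polynomial of what is
left.

The `C_s` are sums of `s`-fold nested commutators. On a chain a bond term commutes with all but a
few of the others, and each commutator enlarges the supporting interval by at most one bond, so a
commutator nested `s` times has at most `(s + 2)! / 2` nonzero terms per initial one. With `w` the
total length of the layers of either kind, `A` or `B`, this gives
`‖C_s‖ ≤ n (1 + w) Λ (4 w Λ) ^ s (s + 2)! / 2`, and the same for the Pauli 1-norm, which is
submultiplicative too.

To compare an arbitrary stage number `κ` with `w`, evaluate the stage form at `A = i e₁₂`,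
`B = i e₂₁`: a product of `κ` stages then has entries polynomial in `x` of degree at most `2 κ`,
whereas the leading power in `S_{2k}` is `x ^ (2 * 5 ^ (k - 1) + 1)`. So `κ > 5 ^ (k - 1)`, while
`w ≤ (7 / 3) ^ (k - 1)`.

The paired formula is `1 + i η P = √(1 + η²) e^{i arctan(η) P}`, valid when `P² = 1`.
-/

noncomputable section

namespace TrotterLCU

/-! ### Products of exponentials in complex time -/

section ExpI

variable {𝒜 : Type*} [NormedRing 𝒜] [NormedAlgebra ℂ 𝒜]

/-- `exp (-i z A)` for a complex time `z`. -/
def expI (A : 𝒜) (z : ℂ) : 𝒜 := NormedSpace.exp ((-(Complex.I * z)) • A)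

theorem expI_zero (A : 𝒜) : expI A 0 = 1 := by simp [expI]

theorem expI_eq_exp_smul (A : 𝒜) : expI A = fun z => NormedSpace.exp (z • (-Complex.I • A)) := by
  funext z
  rw [expI, smul_smul, mul_neg, mul_comm]

variable [CompleteSpace 𝒜]

theorem expI_add (A : 𝒜) (z w : ℂ) : expI A (z + w) = expI A z * expI A w := by
  let _ : NormedAlgebra ℚ 𝒜 := NormedAlgebra.restrictScalars ℚ ℂ 𝒜
  simp only [expI_eq_exp_smul]
  rw [add_smul, NormedSpace.exp_add_of_commute]
  exact ((Commute.refl _).smul_left _).smul_right _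

theorem expI_mul_neg (A : 𝒜) (z : ℂ) : expI A z * expI A (-z) = 1 := by
  rw [← expI_add, add_neg_cancel, expI_zero]

theorem expI_neg_mul (A : 𝒜) (z : ℂ) : expI A (-z) * expI A z = 1 := by
  rw [← expI_add, neg_add_cancel, expI_zero]

theorem hasDerivAt_expI (A : 𝒜) (z : ℂ) :
    HasDerivAt (expI A) (expI A z * (-Complex.I • A)) z := by
  simpa only [expI_eq_exp_smul] using hasDerivAt_exp_smul_const (𝕂 := ℂ) (-Complex.I • A) z

theorem hasDerivAt_expI' (A : 𝒜) (z : ℂ) :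
    HasDerivAt (expI A) ((-Complex.I • A) * expI A z) z := by
  simpa only [expI_eq_exp_smul] using hasDerivAt_exp_smul_const' (𝕂 := ℂ) (-Complex.I • A) z

theorem hasDerivAt_expI_mul (A : 𝒜) (w z : ℂ) :
    HasDerivAt (fun z => expI A (w * z)) (expI A (w * z) * (-(Complex.I * w) • A)) z := by
  refine ((hasDerivAt_expI A (w * z)).scomp z ((hasDerivAt_id z).const_mul w)).congr_deriv ?_
  rw [← mul_smul_comm, smul_smul, mul_one, mul_neg, mul_comm w Complex.I]

theorem hasDerivAt_expI_neg_mul (A : 𝒜) (w z : ℂ) :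
    HasDerivAt (fun z => expI A (-(w * z))) (((Complex.I * w) • A) * expI A (-(w * z))) z := by
  refine ((hasDerivAt_expI' A (-(w * z))).scomp z
    ((hasDerivAt_id z).const_mul w).neg).congr_deriv ?_
  rw [← smul_mul_assoc, smul_smul, mul_one, neg_mul_neg, mul_comm w Complex.I]

theorem differentiable_expI (A : 𝒜) : Differentiable ℂ (expI A) :=
  fun z => (hasDerivAt_expI A z).differentiableAt

theorem differentiable_expI_mul (A : 𝒜) (w : ℂ) : Differentiable ℂ fun z => expI A (w * z) :=
  fun z => (hasDerivAt_expI_mul A w z).differentiableAt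

theorem differentiable_expI_neg_mul (A : 𝒜) (w : ℂ) :
    Differentiable ℂ fun z => expI A (-(w * z)) :=
  fun z => (hasDerivAt_expI_neg_mul A w z).differentiableAt

end ExpI

section Layers

variable {𝒜 ι : Type*} [NormedRing 𝒜] [NormedAlgebra ℂ 𝒜]

/-- The product of the exponentials `exp (-i w z A_b)` over a list of layers `(b, w)`. -/
def layers (op : ι → 𝒜) (l : List (ι × ℝ)) (z : ℂ) : 𝒜 :=
  (l.map fun p => expI (op p.1) (p.2 * z)).prod

/-- The inverse of `layers`. -/
def layersInv (op : ι → 𝒜) (l : List (ι × ℝ)) (z : ℂ) : 𝒜 := layers op l.reverse (-z)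

/-- The generator `S (d/dz S⁻¹ - i H S⁻¹)` of the product formula `S = layers op l`, computed
layer by layer. -/
def layersGen (H : 𝒜) (op : ι → 𝒜) : List (ι × ℝ) → ℂ → 𝒜
  | [], _ => -(Complex.I • H)
  | p :: l, z => expI (op p.1) (p.2 * z) *
      (layersGen H op l z + (Complex.I * p.2) • op p.1) * expI (op p.1) (-(p.2 * z))

/-- The remainder `exp (-i z H) S(z)⁻¹` of the product formula `S = layers op l`. -/
def layersRem (H : 𝒜) (op : ι → 𝒜) (l : List (ι × ℝ)) (z : ℂ) : 𝒜 := expI H z * layersInv op l z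

/-- All layers of a product formula, made `w` times as long. -/
def scaleLayers (w : ℝ) (l : List (ι × ℝ)) : List (ι × ℝ) := l.map fun p => (p.1, w * p.2)

variable (op : ι → 𝒜)

theorem layers_nil (z : ℂ) : layers op [] z = 1 := rfl

theorem layers_cons (p : ι × ℝ) (l : List (ι × ℝ)) (z : ℂ) :
    layers op (p :: l) z = expI (op p.1) (p.2 * z) * layers op l z := by
  rw [layers, List.map_cons, List.prod_cons, ← layers]

theorem layers_append (l l' : List (ι × ℝ)) (z : ℂ) :
    layers op (l ++ l') z = layers op l z * layers op l' z := by
  rw [layers, List.map_append, List.prod_append, ← layers, ← layers]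

theorem layers_scaleLayers (w : ℝ) (l : List (ι × ℝ)) (z : ℂ) :
    layers op (scaleLayers w l) z = layers op l (w * z) := by
  simp only [layers, scaleLayers, List.map_map, Function.comp_def, Complex.ofReal_mul,
    mul_left_comm, mul_assoc]

theorem layers_apply_zero (l : List (ι × ℝ)) : layers op l 0 = 1 := by
  simp [layers, expI_zero]

theorem layersInv_nil (z : ℂ) : layersInv op [] z = 1 := rfl

theorem layersInv_cons (p : ι × ℝ) (l : List (ι × ℝ)) (z : ℂ) :
    layersInv op (p :: l) z = layersInv op l z * expI (op p.1) (-(p.2 * z)) := by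
  rw [layersInv, List.reverse_cons, layers_append, layers_cons, layers_nil, mul_one, mul_neg,
    ← layersInv]

variable [CompleteSpace 𝒜]

theorem layers_mul_layersInv (l : List (ι × ℝ)) (z : ℂ) :
    layers op l z * layersInv op l z = 1 := by
  induction l with
  | nil => rw [layers_nil, layersInv_nil, one_mul]
  | cons p l ih =>
    rw [layers_cons, layersInv_cons, mul_assoc, ← mul_assoc (layers op l z), ih, one_mul,
      expI_mul_neg]

theorem layersInv_mul_layers (l : List (ι × ℝ)) (z : ℂ) :
    layersInv op l z * layers op l z = 1 := by
  induction l with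
  | nil => rw [layers_nil, layersInv_nil, one_mul]
  | cons p l ih =>
    rw [layers_cons, layersInv_cons, mul_assoc, ← mul_assoc (expI _ _), expI_neg_mul, one_mul, ih]

theorem differentiable_layers (l : List (ι × ℝ)) : Differentiable ℂ (layers op l) := by
  induction l with
  | nil => exact differentiable_const 1
  | cons p l ih =>
    simpa only [funext (layers_cons op p l)] using (differentiable_expI_mul _ _).fun_mul ih

theorem differentiable_layersInv (l : List (ι × ℝ)) : Differentiable ℂ (layersInv op l) :=
  (differentiable_layers op l.reverse).comp differentiable_neg

theorem deriv_layers_zero (l : List (ι × ℝ)) :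
    deriv (layers op l) 0 = -Complex.I • (l.map fun p => (p.2 : ℂ) • op p.1).sum := by
  refine HasDerivAt.deriv ?_
  induction l with
  | nil => simpa [funext (layers_nil op)] using hasDerivAt_const (0 : ℂ) (1 : 𝒜)
  | cons p l ih =>
    rw [funext (layers_cons op p l), List.map_cons, List.sum_cons]
    refine ((hasDerivAt_expI_mul (op p.1) p.2 0).mul ih).congr_deriv ?_
    rw [mul_zero, expI_zero, layers_apply_zero, one_mul, one_mul, mul_one]
    module

theorem differentiable_layersGen (H : 𝒜) (l : List (ι × ℝ)) :
    Differentiable ℂ (layersGen H op l) := by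
  induction l with
  | nil => exact differentiable_const _
  | cons p l ih =>
    exact ((differentiable_expI_mul _ _).mul (ih.add_const _)).mul (differentiable_expI_neg_mul _ _)

theorem hasDerivAt_layersInv (H : 𝒜) (l : List (ι × ℝ)) (z : ℂ) :
    HasDerivAt (layersInv op l)
      (layersInv op l z * layersGen H op l z + (Complex.I • H) * layersInv op l z) z := by
  induction l with
  | nil =>
    refine (hasDerivAt_const z (1 : 𝒜)).congr_deriv ?_
    rw [layersInv_nil, layersGen, one_mul, mul_one, neg_add_cancel]
  | cons p l ih =>
    have hE := expI_neg_mul (op p.1) (p.2 * z)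
    rw [layersInv_cons, layersGen, funext (layersInv_cons op p l)]
    refine (ih.mul (hasDerivAt_expI_neg_mul (op p.1) p.2 z)).congr_deriv ?_
    generalize expI (op p.1) (-(p.2 * z)) = E at *
    generalize expI (op p.1) (p.2 * z) = E' at *
    generalize layersGen H op l z = G
    have hcancel : ∀ X : 𝒜, layersInv op l z * E * (E' * X * E) = layersInv op l z * X * E := by
      intro X
      rw [mul_assoc E' X E, ← mul_assoc _ E' _, mul_assoc _ E E', hE, mul_one, ← mul_assoc]
    rw [hcancel]
    noncomm_ring

theorem hasDerivAt_layersRem (H : 𝒜) (l : List (ι × ℝ)) (z : ℂ) :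
    HasDerivAt (layersRem H op l) (layersRem H op l z * layersGen H op l z) z := by
  refine ((hasDerivAt_expI H z).mul (hasDerivAt_layersInv op H l z)).congr_deriv ?_
  simp only [layersRem, neg_smul, mul_add, neg_mul, mul_neg, mul_assoc]
  abel

end Layers

/-! ### Order conditions -/

section Order

variable {𝒜 : Type*} [NormedRing 𝒜]

/-- A time-symmetric formula: a step backwards undoes a step forwards. -/
def IsTimeSymmetric (f : ℂ → 𝒜) : Prop := ∀ z, f z * f (-z) = 1

theorem IsTimeSymmetric.comp_mul {f : ℂ → 𝒜} (hf : IsTimeSymmetric f) (w : ℂ) :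
    IsTimeSymmetric fun z => f (w * z) := fun z => by
  simp only [mul_neg, hf (w * z)]

theorem IsTimeSymmetric.sandwich {f g : ℂ → 𝒜} (hf : IsTimeSymmetric f)
    (hg : IsTimeSymmetric g) : IsTimeSymmetric fun z => f z * g z * f z := fun z =>
  calc f z * g z * f z * (f (-z) * g (-z) * f (-z))
      = f z * (g z * (f z * f (-z)) * g (-z)) * f (-z) := by simp only [mul_assoc]
    _ = 1 := by rw [hf, mul_one, hg, mul_one, hf]

/-- Suzuki's composition `f(uz)² f((1-4u)z) f(uz)²`. -/
def suzukiStep (u : ℂ) (f : ℂ → 𝒜) (z : ℂ) : 𝒜 :=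
  f (u * z) ^ 2 * f ((1 - 4 * u) * z) * f (u * z) ^ 2

theorem IsTimeSymmetric.suzukiStep {f : ℂ → 𝒜} (hf : IsTimeSymmetric f) (u : ℂ) :
    IsTimeSymmetric (suzukiStep u f) := by
  have h := (hf.comp_mul u).sandwich ((hf.comp_mul u).sandwich (hf.comp_mul (1 - 4 * u)))
  simpa only [IsTimeSymmetric, TrotterLCU.suzukiStep, pow_two, mul_assoc] using h

variable [NormedAlgebra ℂ 𝒜]

/-- `f z = exp (-i α z H) + R z ^ m + O(z ^ (m + 1))`. -/
def ApproxEvol (H : 𝒜) (m : ℕ) (α : ℂ) (R : 𝒜) (f : ℂ → 𝒜) : Prop :=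
  ∃ r : ℂ → 𝒜, Differentiable ℂ r ∧ r 0 = R ∧ ∀ z, f z = expI H (α * z) + z ^ m • r z

variable {H R R' : 𝒜} {m : ℕ} {α β : ℂ} {f g : ℂ → 𝒜}

theorem approxEvol_one (m : ℕ) : ApproxEvol H m 0 0 (fun _ => 1) :=
  ⟨0, differentiable_const 0, rfl, fun z => by simp [expI_zero]⟩

theorem ApproxEvol.comp_mul (hf : ApproxEvol H m α R f) (w : ℂ) :
    ApproxEvol H m (α * w) (w ^ m • R) (fun z => f (w * z)) := by
  obtain ⟨r, hr, rfl, hfr⟩ := hf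
  refine ⟨fun z => w ^ m • r (w * z), (hr.comp (differentiable_id.const_mul w)).const_smul (w ^ m),
    by simp only [mul_zero], fun z => ?_⟩
  simp only [hfr, smul_smul, mul_pow, mul_comm (z ^ m), mul_assoc]

theorem ApproxEvol.residue_unique (hf : ApproxEvol H m α R f) (hf' : ApproxEvol H m α R' f) :
    R = R' := by
  obtain ⟨r, hr, rfl, hfr⟩ := hf
  obtain ⟨s, hs, rfl, hfs⟩ := hf'
  have hrs : Set.EqOn r s {0}ᶜ := fun z hz =>
    smul_right_injective 𝒜 (pow_ne_zero m hz) (add_right_injective _ ((hfr z).symm.trans (hfs z)))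
  exact congrFun (hr.continuous.ext_on (dense_compl_singleton 0) hs.continuous hrs) 0

variable [CompleteSpace 𝒜]

theorem exists_eq_smul_of_apply_zero {E : Type*} [NormedAddCommGroup E] [NormedSpace ℂ E]
    [CompleteSpace E] {f : ℂ → E} (hf : Differentiable ℂ f) (hf0 : f 0 = 0) :
    ∃ g : ℂ → E, Differentiable ℂ g ∧ g 0 = deriv f 0 ∧ ∀ z, f z = z • g z := by
  refine ⟨dslope f 0, ?_, dslope_same f 0, fun z => ?_⟩
  · rw [← differentiableOn_univ, Complex.differentiableOn_dslope Filter.univ_mem]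
    exact hf.differentiableOn
  · rw [← sub_smul_dslope_of_zero hf0 z, sub_zero]

theorem ApproxEvol.succ (hf : ApproxEvol H m α 0 f) : ∃ R, ApproxEvol H (m + 1) α R f := by
  obtain ⟨r, hr, hr0, hfr⟩ := hf
  obtain ⟨g, hg, -, hrg⟩ := exists_eq_smul_of_apply_zero hr hr0
  exact ⟨g 0, g, hg, rfl, fun z => by rw [hfr, hrg, smul_smul, pow_succ]⟩

theorem ApproxEvol.mul (hm : m ≠ 0) (hf : ApproxEvol H m α R f) (hg : ApproxEvol H m β R' g) :
    ApproxEvol H m (α + β) (R + R') (fun z => f z * g z) := by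
  obtain ⟨r, hr, rfl, hfr⟩ := hf
  obtain ⟨s, hs, rfl, hgs⟩ := hg
  refine ⟨fun z => r z * expI H (β * z) + expI H (α * z) * s z + z ^ m • (r z * s z), ?_, ?_,
    fun z => ?_⟩
  · exact ((hr.mul (differentiable_expI_mul H β)).add ((differentiable_expI_mul H α).mul hs)).add
      ((differentiable_id.pow m).smul (hr.mul hs))
  · simp [expI_zero, hm]
  · simp only [hfr, hgs, add_mul α, expI_add, mul_add, add_mul, smul_add, smul_mul_assoc,
      mul_smul_comm]
    abel

theorem ApproxEvol.residue_eq_zero (hm : m ≠ 0) (heven : Even m) (hf : ApproxEvol H m 1 R f)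
    (hsymm : IsTimeSymmetric f) : R = 0 := by
  have h := hf.mul hm (hf.comp_mul (-1))
  simp only [heven.neg_one_pow, one_smul, one_mul, add_neg_cancel, neg_mul, hsymm _] at h
  have h2 : (2 : ℂ) • R = 0 := by rw [two_smul, h.residue_unique (approxEvol_one m)]
  exact (smul_eq_zero.1 h2).resolve_left two_ne_zero

/-- By time symmetry the leading error term is of odd degree. -/
theorem ApproxEvol.succ_of_even (hm : m ≠ 0) (heven : Even m) (hf : ApproxEvol H m 1 R f)
    (hsymm : IsTimeSymmetric f) : ∃ R', ApproxEvol H (m + 1) 1 R' f := by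
  obtain rfl := hf.residue_eq_zero hm heven hsymm
  exact hf.succ

theorem ApproxEvol.suzukiStep (hm : m ≠ 0) (hf : ApproxEvol H m 1 R f) (u : ℂ) :
    ApproxEvol H m 1 ((4 * u ^ m + (1 - 4 * u) ^ m) • R) (suzukiStep u f) := by
  have hsq := (hf.comp_mul u).mul hm (hf.comp_mul u)
  have h := (hsq.mul hm (hf.comp_mul (1 - 4 * u))).mul hm hsq
  simp only [← pow_two] at h
  convert h using 1
  · ring
  · module
  · rfl

theorem exists_approxEvol_two_layers {ι : Type*} {op : ι → 𝒜} {l : List (ι × ℝ)}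
    (hl : (l.map fun p => (p.2 : ℂ) • op p.1).sum = H) :
    ∃ R, ApproxEvol H 2 1 R (layers op l) := by
  set d : ℂ → 𝒜 := fun z => layers op l z - expI H z
  have hd : Differentiable ℂ d := (differentiable_layers op l).sub (differentiable_expI H)
  have hd0 : d 0 = 0 := by simp only [d, layers_apply_zero, expI_zero, sub_self]
  have hd1 : deriv d 0 = 0 := by
    rw [deriv_fun_sub (differentiable_layers op l).differentiableAt
      (differentiable_expI H).differentiableAt, deriv_layers_zero, hl,
      (hasDerivAt_expI H 0).deriv, expI_zero, one_mul, sub_self]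
  obtain ⟨g, hg, hg0, hdg⟩ := exists_eq_smul_of_apply_zero hd hd0
  exact ApproxEvol.succ (m := 1) ⟨g, hg, hg0.trans hd1, fun z => by
    rw [one_mul, pow_one, ← hdg, add_sub_cancel]⟩

variable {ι : Type*} {op : ι → 𝒜} {l : List (ι × ℝ)} {K : ℕ}

theorem ApproxEvol.le_analyticOrderAt_layersRem_sub_one
    (h : ApproxEvol H (K + 1) 1 R (layers op l)) :
    (K + 1 : ℕ) ≤ analyticOrderAt (fun z => layersRem H op l z - 1) 0 := by
  obtain ⟨r, hr, -, hS⟩ := h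
  have hRem : Differentiable ℂ (layersRem H op l) :=
    fun z => (hasDerivAt_layersRem op H l z).differentiableAt
  rw [natCast_le_analyticOrderAt ((hRem.sub_const 1).analyticAt 0)]
  refine ⟨fun z => -(r z * layersInv op l z),
    ((hr.mul (differentiable_layersInv op l)).neg).analyticAt 0, .of_forall fun z => ?_⟩
  have hexp : expI H z = layers op l z - z ^ (K + 1) • r z := by
    rw [hS z, one_mul, add_sub_cancel_right]
  simp only [layersRem, hexp, sub_mul, layers_mul_layersInv, smul_mul_assoc, smul_neg,
    sub_zero, sub_sub_cancel_left]

/-- The generator is `V⁻¹ V'` with `V = 1 + O(z ^ (K + 1))` the remainder, hence `O(z ^ K)`. -/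
theorem ApproxEvol.iteratedDeriv_layersGen_eq_zero
    (h : ApproxEvol H (K + 1) 1 R (layers op l)) {s : ℕ} (hs : s < K) :
    iteratedDeriv s (layersGen H op l) 0 = 0 := by
  have hderiv (z : ℂ) := (hasDerivAt_layersRem op H l z).sub_const 1
  have hRem : AnalyticAt ℂ (fun z => layersRem H op l z - 1) 0 :=
    Differentiable.analyticAt (fun z => (hderiv z).differentiableAt) 0
  have hRem0 : layersRem H op l 0 - 1 = 0 := by
    rw [layersRem, layersInv, neg_zero, layers_apply_zero, expI_zero, mul_one, sub_self]
  obtain ⟨g, hg, hgeq⟩ := (natCast_le_analyticOrderAt hRem.deriv).1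
    ((analyticOrderAt_deriv_ge_iff hRem hRem0).2 h.le_analyticOrderAt_layersRem_sub_one)
  have hinv : ∀ z, layers op l z * expI H (-z) * layersRem H op l z = 1 := fun z => by
    rw [layersRem, mul_assoc, ← mul_assoc (expI H (-z)), expI_neg_mul, one_mul,
      layers_mul_layersInv]
  have hinv' : AnalyticAt ℂ (fun z => layers op l z * expI H (-z)) 0 :=
    ((differentiable_layers op l).mul
      ((differentiable_expI H).comp differentiable_neg)).analyticAt 0
  have hGen := (differentiable_layersGen op H l).analyticAt 0
  refine (natCast_le_analyticOrderAt_iff_iteratedDeriv_eq_zero hGen).1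
    ((natCast_le_analyticOrderAt hGen).2 ⟨_, hinv'.mul hg, hgeq.mono fun z hz => ?_⟩) s hs
  rw [(hderiv z).deriv] at hz
  rw [Pi.mul_apply, ← mul_smul_comm, ← hz, ← mul_assoc, hinv, one_mul]

end Order

/-! ### Suzuki's formulas -/

/-- The condition on the order of a Trotter formula: it is `1` or positive and even. -/
def IsTrotterOrder (K : ℕ) : Prop := K = 1 ∨ ∃ k : ℕ, 1 ≤ k ∧ K = 2 * k

/-- The layers of the Trotter formula of order `2 k`; `true` stands for `A`, `false` for `B`. -/
def suzukiLayers : ℕ → List (Bool × ℝ)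
  | 0 => []
  | 1 => [(true, 1 / 2), (false, 1), (true, 1 / 2)]
  | k + 2 =>
    let outer := scaleLayers (suzukiCoeff (k + 2)) (suzukiLayers (k + 1))
    outer ++ outer ++ scaleLayers (1 - 4 * suzukiCoeff (k + 2)) (suzukiLayers (k + 1)) ++
      (outer ++ outer)

/-- The layers of the Trotter formula of order `K`. -/
def trotterLayers (K : ℕ) : List (Bool × ℝ) :=
  if K = 1 then [(false, 1), (true, 1)] else suzukiLayers (K / 2)

theorem trotterLayers_one : trotterLayers 1 = [(false, 1), (true, 1)] := if_pos rfl

theorem trotterLayers_two_mul (k : ℕ) : trotterLayers (2 * k) = suzukiLayers k := by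
  rw [trotterLayers, if_neg (by omega), Nat.mul_div_cancel_left k two_pos]

theorem exists_suzukiCoeff_eq (k : ℕ) :
    ∃ t : ℝ, 1 < t ∧ t ≤ 8 / 5 ∧ t ^ (2 * k + 3) = 4 ∧ suzukiCoeff (k + 2) = 1 / (4 - t) := by
  have hexp : (1 / (2 * ((k + 2 : ℕ) : ℝ) - 1)) = ((2 * k + 3 : ℕ) : ℝ)⁻¹ := by
    rw [one_div]; push_cast; ring
  set t : ℝ := 4 ^ (((2 * k + 3 : ℕ) : ℝ)⁻¹)
  have htpow : t ^ (2 * k + 3) = 4 := Real.rpow_inv_natCast_pow (by norm_num) (by omega)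
  refine ⟨t, Real.one_lt_rpow (by norm_num) (by positivity), ?_, htpow, ?_⟩
  · refine le_of_pow_le_pow_left₀ (n := 2 * k + 3) (by omega) (by norm_num) ?_
    calc t ^ (2 * k + 3) = 4 := htpow
      _ ≤ (8 / 5) ^ 3 := by norm_num
      _ ≤ (8 / 5) ^ (2 * k + 3) := pow_le_pow_right₀ (by norm_num) (by omega)
  · rw [suzukiCoeff, hexp]

theorem suzukiCoeff_mem_Ioc (k : ℕ) : suzukiCoeff (k + 2) ∈ Set.Ioc (1 / 3) (5 / 12) := by
  obtain ⟨t, ht1, ht2, -, hu⟩ := exists_suzukiCoeff_eq k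
  rw [hu]
  constructor
  · exact one_div_lt_one_div_of_lt (by linarith) (by linarith)
  · rw [div_le_div_iff₀ (by linarith) (by norm_num)]
    linarith

theorem four_mul_suzukiCoeff_pow_add (k : ℕ) :
    4 * suzukiCoeff (k + 2) ^ (2 * k + 3) + (1 - 4 * suzukiCoeff (k + 2)) ^ (2 * k + 3) = 0 := by
  obtain ⟨t, -, ht, htpow, hu⟩ := exists_suzukiCoeff_eq k
  have ht4 : 4 - t ≠ 0 := by linarith
  have hmid : 1 - 4 * suzukiCoeff (k + 2) = -(t * suzukiCoeff (k + 2)) := by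
    rw [hu]; field_simp; ring
  rw [hmid, Odd.neg_pow ⟨k + 1, by ring⟩, mul_pow, htpow, add_neg_cancel]

section SuzukiLayers

variable {𝒜 : Type*} [NormedRing 𝒜] [NormedAlgebra ℂ 𝒜] (op : Bool → 𝒜)

theorem layers_suzukiLayers_one (z : ℂ) :
    layers op (suzukiLayers 1) z =
      expI (op true) (1 / 2 * z) * expI (op false) z * expI (op true) (1 / 2 * z) := by
  simp [suzukiLayers, layers, mul_assoc]

theorem layers_suzukiLayers_add_two (k : ℕ) :
    layers op (suzukiLayers (k + 2)) =
      suzukiStep (suzukiCoeff (k + 2)) (layers op (suzukiLayers (k + 1))) := by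
  funext z
  simp only [suzukiLayers, layers_append, layers_scaleLayers, suzukiStep, pow_two]
  push_cast
  rfl

variable [CompleteSpace 𝒜]

theorem isTimeSymmetric_suzukiLayers (k : ℕ) : IsTimeSymmetric (layers op (suzukiLayers k)) := by
  induction k with
  | zero => exact fun _ => mul_one 1
  | succ k ih =>
    cases k with
    | zero =>
      have hexp : ∀ A : 𝒜, IsTimeSymmetric (expI A) := expI_mul_neg
      rw [funext (layers_suzukiLayers_one op)]
      exact ((hexp _).comp_mul (1 / 2)).sandwich (hexp _)
    | succ k =>
      rw [layers_suzukiLayers_add_two]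
      exact ih.suzukiStep _

theorem exists_approxEvol_suzukiLayers (k : ℕ) :
    ∃ R, ApproxEvol (op true + op false) (2 * k + 3) 1 R (layers op (suzukiLayers (k + 1))) := by
  induction k with
  | zero =>
    have hsum : ((suzukiLayers 1).map fun p => (p.2 : ℂ) • op p.1).sum = op true + op false := by
      simp only [suzukiLayers, List.map_cons, List.map_nil, List.sum_cons, List.sum_nil]
      push_cast
      module
    obtain ⟨R, hR⟩ := exists_approxEvol_two_layers hsum
    exact hR.succ_of_even two_ne_zero even_two (isTimeSymmetric_suzukiLayers op 1)
  | succ k ih =>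
    obtain ⟨R, hR⟩ := ih
    have hcoeff : (4 * (suzukiCoeff (k + 2) : ℂ) ^ (2 * k + 3) +
        (1 - 4 * (suzukiCoeff (k + 2) : ℂ)) ^ (2 * k + 3)) = 0 := by
      exact_mod_cast four_mul_suzukiCoeff_pow_add k
    have hstep := hR.suzukiStep (by omega) (suzukiCoeff (k + 2))
    rw [hcoeff, zero_smul, ← layers_suzukiLayers_add_two] at hstep
    obtain ⟨R', hR'⟩ := hstep.succ
    exact hR'.succ_of_even (by omega) ⟨k + 2, by ring⟩ (isTimeSymmetric_suzukiLayers op (k + 2))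

theorem exists_approxEvol_trotterLayers {K : ℕ} (hK : IsTrotterOrder K) :
    ∃ R, ApproxEvol (op true + op false) (K + 1) 1 R (layers op (trotterLayers K)) := by
  rcases hK with rfl | ⟨k, hk, rfl⟩
  · refine exists_approxEvol_two_layers ?_
    simp [trotterLayers_one, add_comm]
  · obtain ⟨k, rfl⟩ := Nat.exists_eq_add_of_le' hk
    rw [trotterLayers_two_mul]
    exact exists_approxEvol_suzukiLayers op k

end SuzukiLayers

/-! ### Locality of nested commutators -/

section Locality

variable {𝒜 ι : Type*} [Ring 𝒜]

/-- A family of elements indexed by the vertices of a graph of degree at most two (`nb j` is the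
closed neighbourhood of `j`) that commute unless they are neighbours. -/
structure IsCommutationChain (h : ι → 𝒜) (nb : ι → Finset ι) : Prop where
  self_mem : ∀ j, j ∈ nb j
  symm : ∀ i j, i ∈ nb j → j ∈ nb i
  card_le : ∀ j, (nb j).card ≤ 3
  comm : ∀ i j, i ∉ nb j → Commute (h i) (h j)

/-- The new vertex `j` has at most two neighbours besides itself, and the one that makes it a
neighbour of `T` is not new. -/
theorem IsCommutationChain.card_biUnion_insert_le [DecidableEq ι] {h : ι → 𝒜} {nb : ι → Finset ι}
    (hc : IsCommutationChain h nb) {T : Finset ι} {j : ι} (hj : j ∈ T.biUnion nb) :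
    ((insert j T).biUnion nb).card ≤ (T.biUnion nb).card + 1 := by
  obtain ⟨t, ht, hjt⟩ := Finset.mem_biUnion.1 hj
  rw [Finset.biUnion_insert]
  by_cases hjT : j ∈ T
  · rw [Finset.union_eq_right.2 (Finset.subset_biUnion_of_mem nb hjT)]
    exact Nat.le_succ _
  have hne : j ≠ t := fun e => hjT (e ▸ ht)
  have hpair : ({j, t} : Finset ι) ⊆ nb j :=
    Finset.insert_subset (hc.self_mem j) (Finset.singleton_subset_iff.2 (hc.symm _ _ hjt))
  have hpairT : ({j, t} : Finset ι) ⊆ T.biUnion nb :=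
    Finset.insert_subset hj
      (Finset.singleton_subset_iff.2 (Finset.mem_biUnion.2 ⟨t, ht, hc.self_mem t⟩))
  have hsub : nb j ∪ T.biUnion nb ⊆ T.biUnion nb ∪ (nb j \ {j, t}) := by
    rw [Finset.union_comm, ← Finset.sdiff_union_of_subset hpair, Finset.sdiff_union_of_subset hpair]
    intro i hi
    by_cases hi' : i ∈ ({j, t} : Finset ι)
    · exact Finset.mem_union_left _ (hpairT hi')
    · simpa [hi'] using hi
  have hnew : (nb j \ {j, t}).card ≤ 1 := by
    have hcard := hc.card_le j
    rw [Finset.card_sdiff_of_subset hpair, Finset.card_pair hne]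
    omega
  calc _ ≤ _ := Finset.card_le_card hsub
    _ ≤ _ := Finset.card_union_le _ _
    _ ≤ _ := by omega

variable [Algebra ℂ 𝒜] [DecidableEq ι]

/-- `X` is a sum of elements `X_i`, each of which is generated by `h j`, `j ∈ T_i`, where
`T_i` has at most `ℓ + 2` neighbours, and `∑ ν X_i ≤ M`. -/
inductive LocalSum (ν : Seminorm ℂ 𝒜) (h : ι → 𝒜) (nb : ι → Finset ι) (ℓ : ℕ) : 𝒜 → ℝ → Prop
  | single (T : Finset ι) (X : 𝒜) (M : ℝ) : (T.biUnion nb).card ≤ ℓ + 2 →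
      X ∈ Algebra.adjoin ℂ (h '' T) → ν X ≤ M → LocalSum ν h nb ℓ X M
  | add (X Y : 𝒜) (M M' : ℝ) : LocalSum ν h nb ℓ X M → LocalSum ν h nb ℓ Y M' →
      LocalSum ν h nb ℓ (X + Y) (M + M')

variable {ν : Seminorm ℂ 𝒜} {h : ι → 𝒜} {nb : ι → Finset ι} {ℓ : ℕ} {X : 𝒜} {M M' Λ : ℝ}

theorem LocalSum.mono (hX : LocalSum ν h nb ℓ X M) (hM : M ≤ M') : LocalSum ν h nb ℓ X M' := by
  induction hX generalizing M' with
  | single T X M hT hX hν => exact .single T X M' hT hX (hν.trans hM)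
  | add X Y M₁ M₂ _ _ ih₁ ih₂ =>
    have hadd := LocalSum.add X Y (M' - M₂) M₂ (ih₁ (by linarith)) (ih₂ le_rfl)
    rwa [sub_add_cancel] at hadd

theorem LocalSum.smul (hX : LocalSum ν h nb ℓ X M) (c : ℂ) :
    LocalSum ν h nb ℓ (c • X) (‖c‖ * M) := by
  induction hX with
  | single T X M hT hX hM =>
    refine .single T _ _ hT (Subalgebra.smul_mem _ hX c) ?_
    rw [map_smul_eq_mul]
    gcongr
  | add X Y M₁ M₂ _ _ ih₁ ih₂ =>
    rw [smul_add, mul_add]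
    exact .add _ _ _ _ ih₁ ih₂

theorem LocalSum.seminorm_le (hX : LocalSum ν h nb ℓ X M) : ν X ≤ M := by
  induction hX with
  | single _ _ _ _ _ hM => exact hM
  | add X Y M₁ M₂ _ _ ih₁ ih₂ => exact (map_add_le_add ν X Y).trans (add_le_add ih₁ ih₂)

theorem localSum_zero : LocalSum ν h nb ℓ 0 0 :=
  .single ∅ 0 0 (by simp) (Subalgebra.zero_mem _) (map_zero ν).le

theorem LocalSum.sum {κ : Type*} (E : Finset κ) (X : κ → 𝒜) (M : κ → ℝ)
    (hX : ∀ j ∈ E, LocalSum ν h nb ℓ (X j) (M j)) :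
    LocalSum ν h nb ℓ (∑ j ∈ E, X j) (∑ j ∈ E, M j) := by
  classical
  induction E using Finset.induction_on with
  | empty => simpa only [Finset.sum_empty] using localSum_zero
  | insert j E hj ih =>
    rw [Finset.sum_insert hj, Finset.sum_insert hj]
    exact .add _ _ _ _ (hX j (by simp)) (ih fun i hi => hX i (by simp [hi]))

namespace IsCommutationChain

variable (hc : IsCommutationChain h nb)
include hc

theorem localSum_sum (hΛ : ∀ j, ν (h j) ≤ Λ) (E : Finset ι) :
    LocalSum ν h nb 1 (∑ j ∈ E, h j) (E.card * Λ) := by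
  have hsum := LocalSum.sum (ℓ := 1) (nb := nb) E h (fun _ => Λ) fun j _ =>
    .single {j} _ _ (by simpa using hc.card_le j) (Algebra.subset_adjoin ⟨j, by simp, rfl⟩) (hΛ j)
  simpa using hsum

theorem commute_of_notMem {T : Finset ι} {j : ι} (hj : j ∉ T.biUnion nb)
    (hX : X ∈ Algebra.adjoin ℂ (h '' T)) : Commute (h j) X := by
  refine Algebra.commute_of_mem_adjoin_of_forall_mem_commute hX fun b hb => ?_
  obtain ⟨t, ht, rfl⟩ := hb
  exact hc.comm _ _ fun hjt => hj (Finset.mem_biUnion.2 ⟨t, ht, hjt⟩)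

variable (hν : ∀ X Y, ν (X * Y) ≤ ν X * ν Y) (hΛ : ∀ j, ν (h j) ≤ Λ)
include hν hΛ

theorem localSum_commutator_term {T : Finset ι} (hT : (T.biUnion nb).card ≤ ℓ + 2)
    (hX : X ∈ Algebra.adjoin ℂ (h '' T)) (hM : ν X ≤ M) {j : ι} (hj : j ∈ T.biUnion nb) :
    LocalSum ν h nb (ℓ + 1) (h j * X - X * h j) (2 * Λ * M) := by
  have hX' : X ∈ Algebra.adjoin ℂ (h '' ↑(insert j T)) :=
    Algebra.adjoin_mono (Set.image_mono (by simp)) hX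
  have hj' : h j ∈ Algebra.adjoin ℂ (h '' ↑(insert j T)) :=
    Algebra.subset_adjoin ⟨j, by simp, rfl⟩
  refine .single (insert j T) _ _ ((hc.card_biUnion_insert_le hj).trans (by omega))
    (Subalgebra.sub_mem _ (Subalgebra.mul_mem _ hj' hX') (Subalgebra.mul_mem _ hX' hj')) ?_
  have hprod : ν (h j) * ν X ≤ Λ * M :=
    mul_le_mul (hΛ j) hM (apply_nonneg ν X) ((apply_nonneg ν _).trans (hΛ j))
  calc ν (h j * X - X * h j) ≤ ν (h j * X) + ν (X * h j) := map_sub_le_add ν _ _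
    _ ≤ ν (h j) * ν X + ν X * ν (h j) := add_le_add (hν _ _) (hν _ _)
    _ ≤ 2 * Λ * M := by linarith [mul_comm (ν X) (ν (h j))]

theorem localSum_commutator_single (hΛ0 : 0 ≤ Λ) {T : Finset ι}
    (hT : (T.biUnion nb).card ≤ ℓ + 2) (hX : X ∈ Algebra.adjoin ℂ (h '' T)) (hM : ν X ≤ M)
    (E : Finset ι) :
    LocalSum ν h nb (ℓ + 1) ((∑ j ∈ E, h j) * X - X * ∑ j ∈ E, h j) (2 * Λ * (ℓ + 2) * M) := by
  have hrestrict : (∑ j ∈ E, h j) * X - X * ∑ j ∈ E, h j =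
      ∑ j ∈ E ∩ T.biUnion nb, (h j * X - X * h j) := by
    rw [Finset.sum_mul, Finset.mul_sum, ← Finset.sum_sub_distrib]
    refine (Finset.sum_subset Finset.inter_subset_left fun j hj hj' => sub_eq_zero.2 ?_).symm
    exact hc.commute_of_notMem (fun hjT => hj' (Finset.mem_inter.2 ⟨hj, hjT⟩)) hX
  rw [hrestrict]
  refine (LocalSum.sum _ _ _ fun j hj =>
    hc.localSum_commutator_term hν hΛ hT hX hM (Finset.mem_inter.1 hj).2).mono ?_
  have hcard : ((E ∩ T.biUnion nb).card : ℝ) ≤ ℓ + 2 := by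
    exact_mod_cast (Finset.card_le_card Finset.inter_subset_right).trans hT
  have hM0 : 0 ≤ 2 * Λ * M := mul_nonneg (by positivity) ((apply_nonneg ν X).trans hM)
  calc ∑ j ∈ E ∩ T.biUnion nb, 2 * Λ * M = (E ∩ T.biUnion nb).card * (2 * Λ * M) := by
        rw [Finset.sum_const, nsmul_eq_mul]
    _ ≤ (ℓ + 2) * (2 * Λ * M) := mul_le_mul_of_nonneg_right hcard hM0
    _ = 2 * Λ * (ℓ + 2) * M := by ring

theorem localSum_commutator (hΛ0 : 0 ≤ Λ) (hX : LocalSum ν h nb ℓ X M) (E : Finset ι) :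
    LocalSum ν h nb (ℓ + 1) ((∑ j ∈ E, h j) * X - X * ∑ j ∈ E, h j) (2 * Λ * (ℓ + 2) * M) := by
  induction hX with
  | single T X M hT hX hM => exact hc.localSum_commutator_single hν hΛ hΛ0 hT hX hM E
  | add X Y M₁ M₂ _ _ ih₁ ih₂ =>
    convert LocalSum.add _ _ _ _ ih₁ ih₂ using 1
    · noncomm_ring
    · ring

end IsCommutationChain

end Locality

/-! ### Growth of the derivatives of the generator -/

theorem iteratedDeriv_clm_comp {E F : Type*} [NormedAddCommGroup E] [NormedSpace ℂ E]
    [NormedAddCommGroup F] [NormedSpace ℂ F] {n : ℕ} {f : ℂ → E} {z : ℂ}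
    (hf : ContDiffAt ℂ n f z) (T : E →L[ℂ] F) :
    iteratedDeriv n (fun z => T (f z)) z = T (iteratedDeriv n f z) := by
  rw [iteratedDeriv_eq_iteratedFDeriv, iteratedDeriv_eq_iteratedFDeriv]
  exact congrArg (· fun _ => (1 : ℂ)) (T.iteratedFDeriv_comp_left hf le_rfl)

section LayerLength

variable {ι : Type*} (m : ι → ℝ)

/-- The total length of the layers `l`, a layer with label `i` counting with weight `m i`. -/
def layerLength (l : List (ι × ℝ)) : ℝ := (l.map fun p => |p.2| * m p.1).sum

theorem layerLength_nil : layerLength m [] = 0 := rfl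

theorem layerLength_cons (p : ι × ℝ) (l : List (ι × ℝ)) :
    layerLength m (p :: l) = |p.2| * m p.1 + layerLength m l := by
  rw [layerLength, List.map_cons, List.sum_cons, ← layerLength]

theorem layerLength_append (l l' : List (ι × ℝ)) :
    layerLength m (l ++ l') = layerLength m l + layerLength m l' := by
  rw [layerLength, List.map_append, List.sum_append, ← layerLength, ← layerLength]

theorem layerLength_scaleLayers (w : ℝ) (l : List (ι × ℝ)) :
    layerLength m (scaleLayers w l) = |w| * layerLength m l := by
  simp only [layerLength, scaleLayers, List.map_map, Function.comp_def, abs_mul, mul_assoc,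
    List.sum_map_mul_left]

theorem layerLength_nonneg {m : ι → ℝ} (hm : ∀ i, 0 ≤ m i) (l : List (ι × ℝ)) :
    0 ≤ layerLength m l :=
  List.sum_nonneg fun _ hx => by
    obtain ⟨p, -, rfl⟩ := List.mem_map.1 hx
    exact mul_nonneg (abs_nonneg _) (hm p.1)

end LayerLength

section TwistDeriv

variable {𝒜 : Type*} [NormedRing 𝒜] [NormedAlgebra ℂ 𝒜]

/-- The commutator with `A` as a continuous linear map. -/
def commutatorCLM (A : 𝒜) : 𝒜 →L[ℂ] 𝒜 :=
  ContinuousLinearMap.mul ℂ 𝒜 A - (ContinuousLinearMap.mul ℂ 𝒜).flip A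

theorem commutatorCLM_apply (A X : 𝒜) : commutatorCLM A X = A * X - X * A := rfl

/-- The function `Z_s` with `(e^{-iwzA} f e^{iwzA})^{(s)} = e^{-iwzA} Z_s e^{iwzA}`. -/
def twistDeriv (A : 𝒜) (w : ℂ) (f : ℂ → 𝒜) : ℕ → ℂ → 𝒜
  | 0 => f
  | s + 1 => fun z =>
      deriv (twistDeriv A w f s) z + (-(Complex.I * w) • commutatorCLM A) (twistDeriv A w f s z)

variable [CompleteSpace 𝒜] {f : ℂ → 𝒜}

theorem differentiable_twistDeriv (A : 𝒜) (w : ℂ) (hf : Differentiable ℂ f) (s : ℕ) :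
    Differentiable ℂ (twistDeriv A w f s) := by
  induction s with
  | zero => exact hf
  | succ s ih => exact ih.deriv.add ((-(Complex.I * w) • commutatorCLM A).differentiable.comp ih)

theorem iteratedDeriv_conj_expI (A : 𝒜) (w : ℂ) (hf : Differentiable ℂ f) (s : ℕ) :
    iteratedDeriv s (fun z => expI A (w * z) * f z * expI A (-(w * z))) =
      fun z => expI A (w * z) * twistDeriv A w f s z * expI A (-(w * z)) := by
  induction s with
  | zero => rw [iteratedDeriv_zero, twistDeriv]
  | succ s ih =>
    rw [iteratedDeriv_succ, ih]
    funext z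
    refine (((hasDerivAt_expI_mul A w z).mul
      (differentiable_twistDeriv A w hf s z).hasDerivAt).mul
        (hasDerivAt_expI_neg_mul A w z)).deriv.trans ?_
    simp only [twistDeriv, smul_apply, commutatorCLM_apply, neg_smul, mul_add,
      add_mul, neg_mul, mul_neg, smul_sub, mul_assoc, mul_sub, sub_mul, smul_mul_assoc,
      mul_smul_comm, Pi.mul_apply]
    abel

theorem iteratedDeriv_twistDeriv_succ (A : 𝒜) (w : ℂ) (hf : Differentiable ℂ f) (s t : ℕ)
    (z : ℂ) :
    iteratedDeriv t (twistDeriv A w f (s + 1)) z =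
      iteratedDeriv (t + 1) (twistDeriv A w f s) z +
        -(Complex.I * w) • (A * iteratedDeriv t (twistDeriv A w f s) z -
          iteratedDeriv t (twistDeriv A w f s) z * A) := by
  have hd := differentiable_twistDeriv A w hf s
  have hcomm : ContDiff ℂ t fun z => (-(Complex.I * w) • commutatorCLM A) (twistDeriv A w f s z) :=
    ((-(Complex.I * w) • commutatorCLM A).differentiable.comp hd).contDiff
  rw [twistDeriv, iteratedDeriv_fun_add hd.deriv.contDiff.contDiffAt hcomm.contDiffAt,
    ← iteratedDeriv_succ', iteratedDeriv_clm_comp hd.contDiff.contDiffAt]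
  rfl

end TwistDeriv

section Growth

variable {𝒜 ι : Type*} [NormedRing 𝒜] [NormedAlgebra ℂ 𝒜]

/-- All the derivatives of `f` at `0` are sums of local terms, the `s`th one of total size
`M (2 c Λ) ^ s (s + 2)! / 2`. Here `c` is the total length of the layers that `f` has been
conjugated with; conjugation by a further one preserves this form of the bound. -/
def LocalGrowth [DecidableEq ι] (ν : Seminorm ℂ 𝒜) (h : ι → 𝒜) (nb : ι → Finset ι) (Λ c M : ℝ)
    (f : ℂ → 𝒜) : Prop :=
  ∀ s, LocalSum ν h nb (s + 1) (iteratedDeriv s f 0)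
    (M * (2 * c * Λ) ^ s * ((s + 2).factorial / 2))

variable [DecidableEq ι] {ν : Seminorm ℂ 𝒜} {h : ι → 𝒜} {nb : ι → Finset ι} {Λ c M M' : ℝ}
  {f g : ℂ → 𝒜}

theorem localGrowth_const (hΛ0 : 0 ≤ Λ) (hc : 0 ≤ c) {X : 𝒜} (hX : LocalSum ν h nb 1 X M) :
    LocalGrowth ν h nb Λ c M (fun _ => X) := fun s => by
  rw [iteratedDeriv_const]
  rcases s.eq_zero_or_pos with rfl | hs
  · simpa using hX
  · have hM : 0 ≤ M := (apply_nonneg ν X).trans hX.seminorm_le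
    rw [if_neg hs.ne']
    exact localSum_zero.mono (by positivity)

variable [CompleteSpace 𝒜]

theorem LocalGrowth.add (hf : LocalGrowth ν h nb Λ c M f) (hg : LocalGrowth ν h nb Λ c M' g)
    (hf' : Differentiable ℂ f) (hg' : Differentiable ℂ g) :
    LocalGrowth ν h nb Λ c (M + M') (fun z => f z + g z) := fun s => by
  rw [iteratedDeriv_fun_add hf'.contDiff.contDiffAt hg'.contDiff.contDiffAt]
  convert (hf s).add _ _ _ _ (hg s) using 1
  ring

variable (hc : IsCommutationChain h nb) (hν : ∀ X Y, ν (X * Y) ≤ ν X * ν Y)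
  (hΛ : ∀ j, ν (h j) ≤ Λ) (hΛ0 : 0 ≤ Λ)
include hc hν hΛ hΛ0

theorem LocalGrowth.localSum_twistDeriv (hf : LocalGrowth ν h nb Λ c M f)
    (hf' : Differentiable ℂ f) (E : Finset ι) (w : ℝ) (s t : ℕ) :
    LocalSum ν h nb (s + t + 1) (iteratedDeriv t (twistDeriv (∑ j ∈ E, h j) w f s) 0)
      (M * (2 * (c + |w|) * Λ) ^ s * (2 * c * Λ) ^ t * ((s + t + 2).factorial / 2)) := by
  induction s generalizing t with
  | zero => simpa [twistDeriv] using hf t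
  | succ s ih =>
    have hcomm := (hc.localSum_commutator hν hΛ hΛ0 (ih t) E).smul (-(Complex.I * w))
    rw [iteratedDeriv_twistDeriv_succ _ _ hf', show s + 1 + t + 1 = s + t + 1 + 1 by ring]
    refine (LocalSum.add _ _ _ _ (ih (t + 1)) hcomm).mono (le_of_eq ?_)
    rw [show s + (t + 1) + 2 = (s + t + 2) + 1 by ring,
      show s + 1 + t + 2 = (s + t + 2) + 1 by ring, Nat.factorial_succ]
    simp only [norm_neg, norm_mul, Complex.norm_I, Complex.norm_real, Real.norm_eq_abs, one_mul]
    push_cast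
    ring

theorem LocalGrowth.conj (hf : LocalGrowth ν h nb Λ c M f) (hf' : Differentiable ℂ f)
    (E : Finset ι) (w : ℝ) :
    LocalGrowth ν h nb Λ (c + |w|) M
      (fun z => expI (∑ j ∈ E, h j) (w * z) * f z * expI (∑ j ∈ E, h j) (-(w * z))) := fun s => by
  rw [iteratedDeriv_conj_expI _ _ hf']
  simpa [expI_zero] using hf.localSum_twistDeriv hc hν hΛ hΛ0 hf' E w s 0

variable {σ : Type*} (E : σ → Finset ι) (E' : Finset ι) (l : List (σ × ℝ))

theorem localGrowth_layersGen :
    LocalGrowth ν h nb Λ (layerLength 1 l) ((E'.card + layerLength (fun i => (E i).card) l) * Λ)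
      (layersGen (∑ j ∈ E', h j) (fun i => ∑ j ∈ E i, h j) l) := by
  induction l with
  | nil =>
    have hH := (hc.localSum_sum hΛ E').smul (-Complex.I)
    rw [norm_neg, Complex.norm_I, one_mul, neg_smul] at hH
    simpa only [layerLength_nil, add_zero] using! localGrowth_const hΛ0 le_rfl hH
  | cons p l ih =>
    have hA := (hc.localSum_sum hΛ (E p.1)).smul (Complex.I * p.2)
    rw [norm_mul, Complex.norm_I, one_mul, Complex.norm_real, Real.norm_eq_abs] at hA
    have hl : 0 ≤ layerLength 1 l := layerLength_nonneg (fun _ => zero_le_one) l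
    have hd := differentiable_layersGen (fun i => ∑ j ∈ E i, h j) (∑ j ∈ E', h j) l
    convert (ih.add (localGrowth_const hΛ0 hl hA) hd (differentiable_const _)).conj hc hν hΛ hΛ0
      (hd.add (differentiable_const _)) (E p.1) p.2 using 1
    · rw [layerLength_cons, Pi.one_apply, mul_one, add_comm]
    · rw [layerLength_cons]; ring
    · rfl

omit [DecidableEq ι] in
theorem seminorm_iteratedDeriv_layersGen_le (s : ℕ) :
    ν (iteratedDeriv s (layersGen (∑ j ∈ E', h j) (fun i => ∑ j ∈ E i, h j) l) 0) ≤
      (E'.card + layerLength (fun i => (E i).card) l) * Λ *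
        (2 * layerLength 1 l * Λ) ^ s * ((s + 2).factorial / 2) := by
  classical exact (localGrowth_layersGen hc hν hΛ hΛ0 E E' l s).seminorm_le

end Growth

/-! ### Stage lengths of Suzuki's formulas -/

/-- The total length of the layers of either kind in Suzuki's formula of order `2 (k + 1)`. -/
def suzukiWeight : ℕ → ℝ
  | 0 => 1
  | k + 1 => (4 * |suzukiCoeff (k + 2)| + |1 - 4 * suzukiCoeff (k + 2)|) * suzukiWeight k

theorem suzukiWeight_pos (k : ℕ) : 0 < suzukiWeight k := by
  induction k with
  | zero => exact one_pos
  | succ k ih =>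
    have hu : suzukiCoeff (k + 2) ≠ 0 := by linarith [(suzukiCoeff_mem_Ioc k).1]
    rw [suzukiWeight]
    positivity

theorem suzukiWeight_le (k : ℕ) : suzukiWeight k ≤ (7 / 3) ^ k := by
  induction k with
  | zero => exact le_rfl
  | succ k ih =>
    obtain ⟨hu, hu'⟩ := suzukiCoeff_mem_Ioc k
    rw [suzukiWeight, pow_succ', abs_of_nonneg (by linarith), abs_of_nonpos (by linarith)]
    exact mul_le_mul (by linarith) ih (suzukiWeight_pos k).le (by norm_num)

theorem layerLength_suzukiLayers (m : Bool → ℝ) (k : ℕ) :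
    layerLength m (suzukiLayers (k + 1)) = suzukiWeight k * (m true + m false) := by
  induction k with
  | zero =>
    norm_num [suzukiLayers, suzukiWeight, layerLength_cons, layerLength_nil]
    ring
  | succ k ih =>
    simp only [suzukiLayers, layerLength_append, layerLength_scaleLayers, ih, suzukiWeight]
    ring

/-- The total length of the layers of either kind in the Trotter formula of order `K`. -/
def trotterWeight (K : ℕ) : ℝ := if K = 1 then 1 else suzukiWeight (K / 2 - 1)

theorem trotterWeight_one : trotterWeight 1 = 1 := if_pos rfl

theorem trotterWeight_two_mul_succ (k : ℕ) : trotterWeight (2 * (k + 1)) = suzukiWeight k := by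
  rw [trotterWeight, if_neg (by omega), Nat.mul_div_cancel_left _ two_pos, Nat.add_sub_cancel]

theorem trotterWeight_pos (K : ℕ) : 0 < trotterWeight K := by
  rw [trotterWeight]
  split_ifs
  · exact one_pos
  · exact suzukiWeight_pos _

theorem layerLength_trotterLayers (m : Bool → ℝ) {K : ℕ} (hK : IsTrotterOrder K) :
    layerLength m (trotterLayers K) = trotterWeight K * (m true + m false) := by
  rcases hK with rfl | ⟨k, hk, rfl⟩
  · norm_num [trotterLayers_one, trotterWeight_one, layerLength_cons, layerLength_nil, add_comm]
  · obtain ⟨k, rfl⟩ := Nat.exists_eq_add_of_le' hk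
    rw [trotterLayers_two_mul, trotterWeight_two_mul_succ, layerLength_suzukiLayers]

/-! ### Product formulas of matrices -/

section MatrixLayers

variable {m : Type} [Fintype m] [DecidableEq m]

theorem evol_eq_expI (A : Matrix m m ℂ) (x : ℝ) : evol A x = expI A x := rfl

theorem suzuki_eq_layers (op : Bool → Matrix m m ℂ) (k : ℕ) (x : ℝ) :
    suzuki (op true) (op false) k x = layers op (suzukiLayers k) x := by
  induction k using Nat.twoStepInduction generalizing x with
  | zero => rfl
  | one =>
    rw [suzuki, layers_suzukiLayers_one, evol_eq_expI, evol_eq_expI, div_eq_inv_mul]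
    simp only [Complex.ofReal_mul, Complex.ofReal_inv, Complex.ofReal_ofNat, one_div]
  | more k _ ih =>
    rw [suzuki, layers_suzukiLayers_add_two, ih, ih, suzukiStep]
    push_cast
    rfl

theorem trotter_eq_layers (op : Bool → Matrix m m ℂ) (K : ℕ) (x : ℝ) :
    trotter (op true) (op false) K x = layers op (trotterLayers K) x := by
  rw [trotter, trotterLayers]
  split_ifs
  · simp [layers, evol_eq_expI]
  · exact suzuki_eq_layers op _ x

theorem conjTranspose_expI {A : Matrix m m ℂ} (hA : A.IsHermitian) (x : ℝ) :
    (expI A x)ᴴ = expI A (-x) := by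
  rw [expI, ← Matrix.exp_conjTranspose, Matrix.conjTranspose_smul, hA, expI]
  simp

theorem expI_mem_unitaryGroup {A : Matrix m m ℂ} (hA : A.IsHermitian) (x : ℝ) :
    expI A x ∈ Matrix.unitaryGroup m ℂ := by
  rw [Matrix.mem_unitaryGroup_iff, Matrix.star_eq_conjTranspose, conjTranspose_expI hA,
    expI_mul_neg]

section Hermitian

variable {ι : Type*} {op : ι → Matrix m m ℂ} (hop : ∀ i, (op i).IsHermitian)
include hop

theorem conjTranspose_layers (l : List (ι × ℝ)) (x : ℝ) :
    (layers op l x)ᴴ = layersInv op l x := by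
  induction l with
  | nil => rw [layers_nil, layersInv_nil, Matrix.conjTranspose_one]
  | cons p l ih =>
    rw [layers_cons, layersInv_cons, Matrix.conjTranspose_mul, ih, ← Complex.ofReal_mul,
      conjTranspose_expI (hop _)]

theorem layers_mem_unitaryGroup (l : List (ι × ℝ)) (x : ℝ) :
    layers op l x ∈ Matrix.unitaryGroup m ℂ := by
  rw [Matrix.mem_unitaryGroup_iff, Matrix.star_eq_conjTranspose, conjTranspose_layers hop,
    layers_mul_layersInv]

theorem conjTranspose_layersGen {H : Matrix m m ℂ} (hH : H.IsHermitian) (l : List (ι × ℝ))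
    (x : ℝ) : (layersGen H op l x)ᴴ = -layersGen H op l x := by
  induction l with
  | nil => simp [layersGen, Matrix.conjTranspose_smul, hH.eq]
  | cons p l ih =>
    have hexp : (expI (op p.1) (p.2 * x))ᴴ = expI (op p.1) (-(p.2 * x)) := by
      rw [← Complex.ofReal_mul, conjTranspose_expI (hop _)]
    have hcoeff : star (Complex.I * (p.2 : ℂ)) = -(Complex.I * p.2) := by simp
    rw [layersGen, Matrix.conjTranspose_mul, Matrix.conjTranspose_mul, hexp, ← hexp,
      Matrix.conjTranspose_conjTranspose, Matrix.conjTranspose_add, ih,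
      Matrix.conjTranspose_smul, (hop _).eq, hcoeff, neg_smul, ← neg_add, neg_mul, mul_neg,
      mul_assoc]

end Hermitian

end MatrixLayers

/-! ### The least number of stages -/

section Leading

open Filter Topology

variable {𝒜 : Type*} [Ring 𝒜] [Algebra ℝ 𝒜] [TopologicalSpace 𝒜]

/-- `f x = x ^ e X + o(x ^ e)` as `|x| → ∞`. -/
def HasLeading (e : ℕ) (f : ℝ → 𝒜) (X : 𝒜) : Prop :=
  Tendsto (fun x : ℝ => (x ^ e)⁻¹ • f x) (Bornology.cobounded ℝ) (𝓝 X)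

variable {e e' : ℕ} {f g : ℝ → 𝒜} {X Y : 𝒜}

theorem HasLeading.mul [ContinuousMul 𝒜] (hf : HasLeading e f X) (hg : HasLeading e' g Y) :
    HasLeading (e + e') (fun x => f x * g x) (X * Y) :=
  (Tendsto.mul hf hg).congr fun x => by rw [smul_mul_smul_comm, pow_add, mul_inv]

theorem hasLeading_list_prod [ContinuousMul 𝒜] (e : ℕ) (L : List (ℝ → 𝒜))
    (hL : ∀ f ∈ L, ∃ X, HasLeading e f X) :
    ∃ X, HasLeading (e * L.length) (fun x => (L.map fun f => f x).prod) X := by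
  induction L with
  | nil =>
    refine ⟨1, tendsto_const_nhds.congr fun x => ?_⟩
    simp only [List.length_nil, mul_zero, pow_zero, inv_one, one_smul, List.map_nil, List.prod_nil]
  | cons f L ih =>
    obtain ⟨X, hX⟩ := hL f List.mem_cons_self
    obtain ⟨Y, hY⟩ := ih fun g hg => hL g (List.mem_cons_of_mem f hg)
    refine ⟨X * Y, ?_⟩
    simpa only [List.length_cons, List.map_cons, List.prod_cons, mul_add, mul_one, add_comm]
      using hX.mul hY

variable [ContinuousSMul ℝ 𝒜]

theorem HasLeading.comp_mul (hf : HasLeading e f X) {w : ℝ} (hw : w ≠ 0) :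
    HasLeading e (fun x => f (w * x)) (w ^ e • X) := by
  refine ((hf.comp (tendsto_mul_left_cobounded hw)).const_smul (w ^ e)).congr fun x => ?_
  rw [Function.comp_apply, smul_smul, mul_pow, mul_inv, mul_inv_cancel_left₀ (pow_ne_zero e hw)]

theorem HasLeading.le [T2Space 𝒜] (hf : HasLeading e f X) (hX : X ≠ 0) (hg : HasLeading e' f Y) :
    e ≤ e' := by
  by_contra! hlt
  obtain ⟨d, rfl⟩ := Nat.exists_eq_add_of_lt hlt
  have hzero : Tendsto (fun x : ℝ => x⁻¹ ^ (d + 1) • (x ^ e')⁻¹ • f x)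
      (Bornology.cobounded ℝ) (𝓝 ((0 : ℝ) ^ (d + 1) • Y)) :=
    (tendsto_inv₀_cobounded.pow _).smul hg
  rw [zero_pow d.succ_ne_zero, zero_smul] at hzero
  refine hX (tendsto_nhds_unique hf (hzero.congr fun x => ?_))
  rw [smul_smul, inv_pow, ← mul_inv, ← pow_add, add_comm (d + 1),
    ← add_assoc]

theorem hasLeading_one_add_smul [ContinuousAdd 𝒜] (X Y : 𝒜) (w : ℝ) :
    HasLeading 1 (fun x => Y + (w * x) • X) (w • X) := by
  have hlim := ((tendsto_inv₀_cobounded (α := ℝ)).smul_const Y).add_const (w • X)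
  rw [zero_smul, zero_add] at hlim
  refine hlim.congr' ?_
  filter_upwards [Bornology.eventually_ne_cobounded (0 : ℝ)] with x hx
  rw [pow_one, smul_add, smul_smul, mul_comm w, inv_mul_cancel_left₀ hx]

end Leading

section Shear

/-- The nilpotent matrices `e₁₂` (for `true`) and `e₂₁` (for `false`). -/
def nilp : Bool → Matrix (Fin 2) (Fin 2) ℂ
  | true => !![0, 1; 0, 0]
  | false => !![0, 0; 1, 0]

theorem nilp_mul_self (b : Bool) : nilp b * nilp b = 0 := by
  cases b <;> ext i j <;> fin_cases i <;> fin_cases j <;> simp [nilp]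

theorem nilp_mul_nilp_not_mul_nilp (b : Bool) : nilp b * nilp (!b) * nilp b = nilp b := by
  cases b <;> ext i j <;> fin_cases i <;> fin_cases j <;> simp [nilp]

theorem nilp_ne_zero (b : Bool) : nilp b ≠ 0 := by
  cases b
  · exact fun h => by simpa [nilp] using congrFun (congrFun h 1) 0
  · exact fun h => by simpa [nilp] using congrFun (congrFun h 0) 1

/-- The evolution of `i e₁₂` or `i e₂₁`, linear in time. -/
def shear (b : Bool) (t : ℝ) : Matrix (Fin 2) (Fin 2) ℂ := 1 + t • nilp b

theorem shear_add (b : Bool) (s t : ℝ) : shear b (s + t) = shear b s * shear b t := by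
  simp only [shear, add_mul, mul_add, one_mul, mul_one, smul_mul_smul_comm, nilp_mul_self,
    smul_zero, add_zero, add_smul]
  abel

theorem evol_I_smul_nilp (b : Bool) (t : ℝ) : evol (Complex.I • nilp b) t = shear b t := by
  have harg : -(Complex.I * t) • Complex.I • nilp b = t • nilp b := by
    rw [smul_smul, ← Complex.coe_smul]
    congr 1
    linear_combination (-t : ℂ) * Complex.I_mul_I
  rw [evol, harg, NormedSpace.exp_eq_tsum ℝ]
  simp only
  rw [tsum_eq_sum (s := Finset.range 2)]
  · simp [Finset.sum_range_succ, shear]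
  · intro k hk
    obtain ⟨k, rfl⟩ := Nat.exists_eq_add_of_le' (not_lt.1 (Finset.mem_range.not.1 hk))
    rw [pow_add, sq, smul_mul_smul_comm, nilp_mul_self, smul_zero, mul_zero, smul_zero]

/-- `f` grows like a nonzero multiple of `x ^ e` in the direction of `nilp b`. -/
def LeadsWith (e : ℕ) (f : ℝ → Matrix (Fin 2) (Fin 2) ℂ) (b : Bool) : Prop :=
  ∃ c : ℝ, c ≠ 0 ∧ HasLeading e f (c • nilp b)

variable {e₁ e₂ e₃ : ℕ} {f g k : ℝ → Matrix (Fin 2) (Fin 2) ℂ} {b : Bool}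

theorem hasLeading_shear (b : Bool) (w : ℝ) :
    HasLeading 1 (fun x => shear b (w * x)) (w • nilp b) :=
  hasLeading_one_add_smul (nilp b) 1 w

theorem leadsWith_shear (b : Bool) {w : ℝ} (hw : w ≠ 0) :
    LeadsWith 1 (fun x => shear b (w * x)) b :=
  ⟨w, hw, hasLeading_shear b w⟩

theorem LeadsWith.comp_mul (hf : LeadsWith e₁ f b) {w : ℝ} (hw : w ≠ 0) :
    LeadsWith e₁ (fun x => f (w * x)) b := by
  obtain ⟨c, hc, hf⟩ := hf
  refine ⟨w ^ e₁ * c, mul_ne_zero (pow_ne_zero _ hw) hc, ?_⟩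
  rw [mul_smul]
  exact hf.comp_mul hw

theorem LeadsWith.sandwich (hf : LeadsWith e₁ f b) (hg : LeadsWith e₂ g (!b))
    (hk : LeadsWith e₃ k b) : LeadsWith (e₁ + e₂ + e₃) (fun x => f x * g x * k x) b := by
  obtain ⟨c₁, hc₁, hf⟩ := hf
  obtain ⟨c₂, hc₂, hg⟩ := hg
  obtain ⟨c₃, hc₃, hk⟩ := hk
  refine ⟨c₁ * c₂ * c₃, mul_ne_zero (mul_ne_zero hc₁ hc₂) hc₃, ?_⟩
  have hprod := (hf.mul hg).mul hk
  rwa [smul_mul_smul_comm, smul_mul_smul_comm, nilp_mul_nilp_not_mul_nilp] at hprod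

theorem LeadsWith.le {X : Matrix (Fin 2) (Fin 2) ℂ} (hf : LeadsWith e₁ f b)
    (hX : HasLeading e₂ f X) : e₁ ≤ e₂ := by
  obtain ⟨c, hc, hf⟩ := hf
  exact hf.le (smul_ne_zero hc (nilp_ne_zero b)) hX

end Shear

section Stages

/-- Suzuki's formula for `A = i e₁₂` and `B = i e₂₁`. -/
def suzukiNilp (k : ℕ) : ℝ → Matrix (Fin 2) (Fin 2) ℂ :=
  suzuki (Complex.I • nilp true) (Complex.I • nilp false) k

/-- In the recursion two adjacent outer layers of `A` merge, with lengths `2 α u` or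
`α (1 - 3 u)`, and neither of these is zero. -/
theorem suzukiNilp_eq_sandwich (k : ℕ) :
    ∃ (α : ℝ) (P : ℝ → Matrix (Fin 2) (Fin 2) ℂ), α ≠ 0 ∧ LeadsWith (2 * 5 ^ k - 1) P false ∧
      ∀ x, suzukiNilp (k + 1) x = shear true (α * x) * P x * shear true (α * x) := by
  induction k with
  | zero =>
    refine ⟨1 / 2, shear false, by norm_num, by simpa using leadsWith_shear false one_ne_zero,
      fun x => ?_⟩
    rw [suzukiNilp, suzuki, evol_I_smul_nilp, evol_I_smul_nilp, div_eq_inv_mul, one_div]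
  | succ k ih =>
    obtain ⟨α, P, hα, hP, hsand⟩ := ih
    obtain ⟨hu, -⟩ := suzukiCoeff_mem_Ioc k
    set u := suzukiCoeff (k + 2)
    have hu0 : u ≠ 0 := by linarith
    have hmid0 : 1 - 4 * u ≠ 0 := by linarith
    have houter : LeadsWith 1 (fun x => shear true (α * u * x + α * u * x)) true := by
      simpa only [← add_mul] using leadsWith_shear true (w := α * u + α * u)
        (by rw [← two_mul]; positivity)
    have hinner : LeadsWith 1 (fun x => shear true (α * u * x + α * (1 - 4 * u) * x)) true := by
      simpa only [← add_mul] using leadsWith_shear true (w := α * u + α * (1 - 4 * u))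
        (by rw [← mul_add]; exact mul_ne_zero hα (by linarith))
    have hinner' : LeadsWith 1 (fun x => shear true (α * (1 - 4 * u) * x + α * u * x)) true := by
      simpa only [add_comm] using hinner
    have hPu := hP.comp_mul hu0
    have hprod := (((hPu.sandwich houter hPu).sandwich hinner (hP.comp_mul hmid0)).sandwich
      hinner' hPu).sandwich houter hPu
    have hexponent : 2 * 5 ^ (k + 1) - 1 = 5 * (2 * 5 ^ k - 1) + 4 := by
      have hpos : 1 ≤ 5 ^ k := Nat.one_le_pow _ _ (by norm_num)
      rw [pow_succ]
      omega
    refine ⟨α * u, _, mul_ne_zero hα hu0, by convert hprod using 1; omega, fun x => ?_⟩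
    have hrec : suzukiNilp (k + 2) x = suzukiNilp (k + 1) (u * x) ^ 2 *
        suzukiNilp (k + 1) ((1 - 4 * u) * x) * suzukiNilp (k + 1) (u * x) ^ 2 := rfl
    simp only [hrec, hsand, sq, shear_add, mul_assoc]

theorem exists_hasLeading_stageProduct {κ : ℕ} (a b : Fin κ → ℝ) :
    ∃ X, HasLeading (2 * κ)
      (stageProduct (Complex.I • nilp true) (Complex.I • nilp false) a b) X := by
  set stage : Fin κ → ℝ → Matrix (Fin 2) (Fin 2) ℂ :=
    fun j x => shear false (b j * x) * shear true (a j * x) with hstage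
  have hlead : ∀ f ∈ (List.ofFn stage).reverse, ∃ X, HasLeading (1 + 1) f X := fun f hf => by
    rw [List.mem_reverse, List.mem_ofFn] at hf
    obtain ⟨j, rfl⟩ := hf
    exact ⟨_, (hasLeading_shear false (b j)).mul (hasLeading_shear true (a j))⟩
  obtain ⟨X, hX⟩ := hasLeading_list_prod _ _ hlead
  have hprod : stageProduct (Complex.I • nilp true) (Complex.I • nilp false) a b =
      fun x => ((List.ofFn stage).reverse.map fun f => f x).prod := by
    funext x
    simp only [hstage, stageProduct, evol_I_smul_nilp, List.map_reverse, List.map_ofFn,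
      Function.comp_def]
  rw [List.length_reverse, List.length_ofFn, one_add_one_eq_two] at hX
  exact ⟨X, hprod ▸ hX⟩

variable {κ : ℕ} {a b : Fin κ → ℝ}

theorem five_pow_lt_of_isStageForm {k : ℕ} (h : IsStageForm (2 * (k + 1)) a b) : 5 ^ k < κ := by
  obtain ⟨X, hX⟩ := exists_hasLeading_stageProduct a b
  obtain ⟨α, P, hα, hP, hsand⟩ := suzukiNilp_eq_sandwich k
  have hlead := (leadsWith_shear true hα).sandwich hP (leadsWith_shear true hα)
  have heq : stageProduct (Complex.I • nilp true) (Complex.I • nilp false) a b =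
      fun x => shear true (α * x) * P x * shear true (α * x) := by
    funext x
    rw [← h 2, trotter, if_neg (by omega), Nat.mul_div_cancel_left _ two_pos, ← hsand, suzukiNilp]
  have hle := hlead.le (heq ▸ hX)
  have hpos : 1 ≤ 5 ^ k := Nat.one_le_pow _ _ (by norm_num)
  omega

theorem one_le_of_isStageForm_one (h : IsStageForm 1 a b) : 1 ≤ κ := by
  rcases κ.eq_zero_or_pos with rfl | hκ
  · have hA : evol (0 : Matrix (Fin 2) (Fin 2) ℂ) 1 = 1 := by simp [evol]
    have hone : shear false 1 = 1 := by
      simpa only [trotter, if_pos, evol_I_smul_nilp, hA, mul_one, stageProduct, List.ofFn_zero,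
        List.reverse_nil, List.prod_nil] using h 2 0 (Complex.I • nilp false) 1
    exact absurd (by simpa [shear] using hone) (nilp_ne_zero false)
  · exact hκ

end Stages

/-! ### Pauli strings -/

section KroneckerPi

variable {ι m R : Type*} [Fintype ι] [CommSemiring R]

/-- The tensor product `⨂ i, M i` of a family of square matrices. -/
def kroneckerPi (M : ι → Matrix m m R) : Matrix (ι → m) (ι → m) R :=
  Matrix.of fun s t => ∏ i, M i (s i) (t i)

theorem kroneckerPi_one [DecidableEq m] [DecidableEq (ι → m)] :
    kroneckerPi (fun _ : ι => (1 : Matrix m m R)) = 1 := by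
  ext s t
  simp only [kroneckerPi, Matrix.of_apply, Matrix.one_apply, Finset.prod_ite_zero,
    Finset.prod_const_one, Finset.mem_univ, true_implies, funext_iff]

theorem kroneckerPi_smul (c : ι → R) (M : ι → Matrix m m R) :
    kroneckerPi (fun i => c i • M i) = (∏ i, c i) • kroneckerPi M := by
  ext s t
  simp only [kroneckerPi, Matrix.of_apply, Matrix.smul_apply, smul_eq_mul, Finset.prod_mul_distrib]

theorem conjTranspose_kroneckerPi [StarRing R] (M : ι → Matrix m m R) :
    (kroneckerPi M)ᴴ = kroneckerPi fun i => (M i)ᴴ := by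
  ext s t
  simp only [kroneckerPi, Matrix.conjTranspose_apply, Matrix.of_apply, star_prod]

variable [DecidableEq ι] [Fintype m]

theorem kroneckerPi_mul_kroneckerPi (M M' : ι → Matrix m m R) :
    kroneckerPi M * kroneckerPi M' = kroneckerPi fun i => M i * M' i := by
  ext s t
  simp only [kroneckerPi, Matrix.mul_apply, Matrix.of_apply, ← Finset.prod_mul_distrib,
    Finset.prod_univ_sum, Fintype.piFinset_univ]

theorem trace_kroneckerPi (M : ι → Matrix m m R) :
    (kroneckerPi M).trace = ∏ i, (M i).trace := by
  simp only [kroneckerPi, Matrix.trace, Matrix.diag, Matrix.of_apply, Finset.prod_univ_sum,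
    Fintype.piFinset_univ]

end KroneckerPi

section Pauli

theorem conjTranspose_pauli (p : Fin 4) : (pauli p)ᴴ = pauli p := by
  fin_cases p <;> ext i j <;> fin_cases i <;> fin_cases j <;>
    simp [pauli, Matrix.conjTranspose_apply]

/-- The phase in the product of two Pauli matrices. -/
def pauliPhase : Fin 4 → Fin 4 → ℂ :=
  ![![1, 1, 1, 1], ![1, 1, Complex.I, -Complex.I], ![1, -Complex.I, 1, Complex.I],
    ![1, Complex.I, -Complex.I, 1]]

/-- The label of the product of two Pauli matrices, up to phase. -/
def pauliProd : Fin 4 → Fin 4 → Fin 4 :=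
  ![![0, 1, 2, 3], ![1, 0, 3, 2], ![2, 3, 0, 1], ![3, 2, 1, 0]]

theorem norm_pauliPhase (p q : Fin 4) : ‖pauliPhase p q‖ = 1 := by
  fin_cases p <;> fin_cases q <;> simp [pauliPhase]

theorem pauli_mul_pauli (p q : Fin 4) :
    pauli p * pauli q = pauliPhase p q • pauli (pauliProd p q) := by
  fin_cases p <;> fin_cases q <;> ext i j <;> fin_cases i <;> fin_cases j <;>
    simp [pauli, pauliPhase, pauliProd, Matrix.mul_apply]

theorem pauli_mul_self (p : Fin 4) : pauli p * pauli p = 1 := by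
  fin_cases p <;> ext i j <;> fin_cases i <;> fin_cases j <;> simp [pauli, Matrix.mul_apply]

theorem trace_pauli_mul_pauli (p q : Fin 4) :
    (pauli p * pauli q).trace = if p = q then 2 else 0 := by
  fin_cases p <;> fin_cases q <;> simp [pauli, Matrix.trace, one_add_one_eq_two]

theorem sum_pauli_apply_mul_pauli_apply (a b c d : Fin 2) :
    ∑ p, pauli p a b * pauli p c d = if a = d ∧ b = c then 2 else 0 := by
  fin_cases a <;> fin_cases b <;> fin_cases c <;> fin_cases d <;>
    simp [pauli, Fin.sum_univ_four, one_add_one_eq_two]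

variable {N : ℕ}

theorem pauliOp_eq_kroneckerPi (p : PauliString N) : pauliOp p = kroneckerPi fun j => pauli (p j) :=
  rfl

theorem conjTranspose_pauliOp (p : PauliString N) : (pauliOp p)ᴴ = pauliOp p := by
  simp only [pauliOp_eq_kroneckerPi, conjTranspose_kroneckerPi, conjTranspose_pauli]

theorem pauliOp_mul_pauliOp (p q : PauliString N) : pauliOp p * pauliOp q =
    (∏ j, pauliPhase (p j) (q j)) • pauliOp fun j => pauliProd (p j) (q j) := by
  simp only [pauliOp_eq_kroneckerPi, kroneckerPi_mul_kroneckerPi, pauli_mul_pauli, kroneckerPi_smul]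

theorem pauliOp_mul_self (p : PauliString N) : pauliOp p * pauliOp p = 1 := by
  simp only [pauliOp_eq_kroneckerPi, kroneckerPi_mul_kroneckerPi, pauli_mul_self, kroneckerPi_one]

theorem trace_pauliOp_mul_pauliOp (p q : PauliString N) :
    (pauliOp p * pauliOp q).trace = if p = q then 2 ^ N else 0 := by
  simp only [pauliOp_eq_kroneckerPi, kroneckerPi_mul_kroneckerPi, trace_kroneckerPi,
    trace_pauli_mul_pauli, Finset.prod_ite_zero, Finset.prod_const, Finset.card_univ,
    Fintype.card_fin, Finset.mem_univ, true_implies, funext_iff]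

theorem sum_pauliOp_apply_mul_pauliOp_apply (a b c d : Qubits N) :
    ∑ p : PauliString N, pauliOp p a b * pauliOp p c d = if a = d ∧ b = c then 2 ^ N else 0 := by
  have hfactor : ∑ p : PauliString N, pauliOp p a b * pauliOp p c d =
      ∏ j, ∑ q, pauli q (a j) (b j) * pauli q (c j) (d j) := by
    simp only [pauliOp, Matrix.of_apply, ← Finset.prod_mul_distrib, Finset.prod_univ_sum,
      Fintype.piFinset_univ]
  simp only [hfactor, sum_pauli_apply_mul_pauli_apply, Finset.prod_ite_zero, Finset.prod_const,
    Finset.card_univ, Fintype.card_fin, Finset.mem_univ, true_implies, funext_iff, forall_and]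

theorem sum_pauliCoeff_smul_pauliOp (M : Op N) : ∑ p, pauliCoeff M p • pauliOp p = M := by
  ext s t
  calc (∑ p, pauliCoeff M p • pauliOp p) s t
      = ∑ p : PauliString N, ∑ a, ∑ b, M b a / 2 ^ N * (pauliOp p a b * pauliOp p s t) := by
        simp only [Matrix.sum_apply, Matrix.smul_apply, smul_eq_mul, pauliCoeff, Matrix.trace,
          Matrix.diag, Matrix.mul_apply, Finset.sum_div, Finset.sum_mul]
        exact Finset.sum_congr rfl fun p _ => Finset.sum_congr rfl fun a _ =>
          Finset.sum_congr rfl fun b _ => by ring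
    _ = ∑ a, ∑ b, M b a / 2 ^ N * ∑ p : PauliString N, pauliOp p a b * pauliOp p s t := by
        simp only [Finset.mul_sum]
        rw [Finset.sum_comm]
        exact Finset.sum_congr rfl fun a _ => Finset.sum_comm
    _ = M s t := by
        simp [sum_pauliOp_apply_mul_pauliOp_apply, ite_and]

theorem pauliCoeff_add (X Y : Op N) (p : PauliString N) :
    pauliCoeff (X + Y) p = pauliCoeff X p + pauliCoeff Y p := by
  simp only [pauliCoeff, mul_add, Matrix.trace_add, add_div]

theorem pauliCoeff_smul (c : ℂ) (X : Op N) (p : PauliString N) :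
    pauliCoeff (c • X) p = c * pauliCoeff X p := by
  simp only [pauliCoeff, mul_smul_comm, Matrix.trace_smul, smul_eq_mul, mul_div_assoc]

/-- `pauliNorm` as a seminorm. -/
def pauliSeminorm (N : ℕ) : Seminorm ℂ (Op N) :=
  Seminorm.of pauliNorm
    (fun X Y => by
      simp only [pauliNorm, ← Finset.sum_add_distrib, pauliCoeff_add]
      exact Finset.sum_le_sum fun p _ => norm_add_le _ _)
    (fun c X => by simp only [pauliNorm, pauliCoeff_smul, norm_mul, Finset.mul_sum])

theorem pauliNorm_nonneg (X : Op N) : 0 ≤ pauliNorm X :=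
  apply_nonneg (pauliSeminorm N) X

theorem pauliNorm_smul (c : ℂ) (X : Op N) : pauliNorm (c • X) = ‖c‖ * pauliNorm X :=
  map_smul_eq_mul (pauliSeminorm N) c X

theorem pauliNorm_sum_le {ι : Type*} (s : Finset ι) (f : ι → Op N) :
    pauliNorm (∑ i ∈ s, f i) ≤ ∑ i ∈ s, pauliNorm (f i) :=
  Finset.le_sum_of_subadditive _ (map_zero (pauliSeminorm N)).le
    (map_add_le_add (pauliSeminorm N)) s f

theorem pauliNorm_pauliOp (p : PauliString N) : pauliNorm (pauliOp p) = 1 := by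
  simp [pauliNorm, pauliCoeff, trace_pauliOp_mul_pauliOp, apply_ite, ite_div]

theorem pauliNorm_pauliOp_mul_pauliOp (p q : PauliString N) :
    pauliNorm (pauliOp p * pauliOp q) = 1 := by
  simp only [pauliOp_mul_pauliOp, pauliNorm_smul, pauliNorm_pauliOp, norm_prod, norm_pauliPhase,
    Finset.prod_const_one, mul_one]

theorem pauliNorm_mul_le (X Y : Op N) : pauliNorm (X * Y) ≤ pauliNorm X * pauliNorm Y :=
  calc pauliNorm (X * Y)
      = pauliNorm (∑ p, ∑ q, (pauliCoeff X p * pauliCoeff Y q) • (pauliOp p * pauliOp q)) := by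
        conv_lhs => rw [← sum_pauliCoeff_smul_pauliOp X, ← sum_pauliCoeff_smul_pauliOp Y]
        simp only [Finset.sum_mul_sum, smul_mul_smul_comm]
    _ ≤ ∑ p, ∑ q, pauliNorm ((pauliCoeff X p * pauliCoeff Y q) • (pauliOp p * pauliOp q)) :=
        (pauliNorm_sum_le _ _).trans (Finset.sum_le_sum fun p _ => pauliNorm_sum_le _ _)
    _ = pauliNorm X * pauliNorm Y := by
        simp only [pauliNorm_smul, pauliNorm_pauliOp_mul_pauliOp, mul_one, norm_mul]
        rw [pauliNorm, pauliNorm, Finset.sum_mul_sum]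

theorem pauliCoeff_eq_zero_of_pauliNorm_eq_zero {X : Op N} (h : pauliNorm X = 0)
    (p : PauliString N) : pauliCoeff X p = 0 :=
  norm_eq_zero.1 <| (Finset.sum_eq_zero_iff_of_nonneg fun _ _ => norm_nonneg _).1 h p
    (Finset.mem_univ p)

theorem pauliCoeff_eq_I_mul_im {X : Op N} (hX : Xᴴ = -X) (p : PauliString N) :
    pauliCoeff X p = Complex.I * ((pauliCoeff X p).im : ℂ) := by
  have hstar : star (pauliCoeff X p) = -pauliCoeff X p := by
    rw [pauliCoeff, star_div₀, ← Matrix.trace_conjTranspose, Matrix.conjTranspose_mul, hX,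
      conjTranspose_pauliOp, neg_mul, Matrix.trace_neg, Matrix.trace_mul_comm, neg_div, star_pow,
      star_ofNat]
  have hre : (pauliCoeff X p).re = 0 := by
    have hre := congrArg Complex.re hstar
    rw [Complex.star_def, Complex.conj_re, Complex.neg_re] at hre
    linarith
  apply Complex.ext <;> simp [hre]

end Pauli

/-! ### Operators on disjoint sets of qubits -/

section ActsOn

variable {N : ℕ} {S S' : Set (Fin N)} {M M' : Op N}

theorem ActsOn.apply_eq_zero (hM : ActsOn S M) {s t : Qubits N} {v : Fin N} (hv : v ∉ S)
    (hst : s v ≠ t v) : M s t = 0 := by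
  obtain ⟨T, hT⟩ := hM
  rw [hT, if_neg fun h => hst (h v hv)]

theorem ActsOn.apply_congr (hM : ActsOn S M) {s t s' t' : Qubits N} (hs : S.EqOn s s')
    (ht : S.EqOn t t') (hst : Sᶜ.EqOn s t) (hst' : Sᶜ.EqOn s' t') : M s t = M s' t' := by
  obtain ⟨T, hT⟩ := hM
  have hoff : ∀ v ∉ S, s v = t v := fun v hv => hst hv
  have hoff' : ∀ v ∉ S, s' v = t' v := fun v hv => hst' hv
  rw [hT, hT, if_pos hoff, if_pos hoff']
  exact congrArg₂ T (funext fun v => hs v.2) (funext fun v => ht v.2)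

open Classical in
theorem ActsOn.mul_apply (hM : ActsOn S M) (hM' : ActsOn S' M') (hS : Disjoint S S')
    (s t : Qubits N) : (M * M') s t = M s (S.piecewise t s) * M' (S.piecewise t s) t := by
  rw [Matrix.mul_apply]
  refine Finset.sum_eq_single_of_mem _ (Finset.mem_univ _) fun q _ hq => ?_
  obtain ⟨v, hv⟩ := Function.ne_iff.1 hq
  by_cases hvS : v ∈ S
  · rw [Set.piecewise_eq_of_mem _ _ _ hvS] at hv
    rw [hM'.apply_eq_zero (Set.disjoint_left.1 hS hvS) hv, mul_zero]
  · rw [Set.piecewise_eq_of_notMem _ _ _ hvS] at hv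
    rw [hM.apply_eq_zero hvS hv.symm, zero_mul]

open Classical in
theorem piecewise_eqOn_compl_of_union {ι α : Type*} {S S' : Set ι} {s t : ι → α}
    (hst : (S ∪ S')ᶜ.EqOn s t) : S'ᶜ.EqOn (S.piecewise t s) t := fun v hv => by
  by_cases hvS : v ∈ S
  · exact Set.piecewise_eq_of_mem _ _ _ hvS
  · rw [Set.piecewise_eq_of_notMem _ _ _ hvS, hst fun h => h.elim hvS hv]

theorem ActsOn.commute (hM : ActsOn S M) (hM' : ActsOn S' M') (hS : Disjoint S S') :
    Commute M M' := by
  classical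
  ext s t
  have hS_compl : S ⊆ S'ᶜ := hS.subset_compl_right
  have hS'_compl : S' ⊆ Sᶜ := hS.subset_compl_left
  rw [hM.mul_apply hM' hS, hM'.mul_apply hM hS.symm]
  by_cases hst : (S ∪ S')ᶜ.EqOn s t
  · have hr := piecewise_eqOn_compl_of_union hst
    have hr' := piecewise_eqOn_compl_of_union (Set.union_comm S S' ▸ hst)
    rw [mul_comm]
    congr 1
    · exact hM'.apply_congr ((S.piecewise_eqOn_compl t s).mono hS'_compl)
        (S'.piecewise_eqOn t s).symm hr (S'.piecewise_eqOn_compl t s).symm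
    · exact hM.apply_congr ((S'.piecewise_eqOn_compl t s).mono hS_compl).symm
        (S.piecewise_eqOn t s) (S.piecewise_eqOn_compl t s).symm hr'
  · obtain ⟨v, hv, hne⟩ : ∃ v ∈ (S ∪ S')ᶜ, s v ≠ t v := by
      simpa only [Set.EqOn, not_forall, exists_prop] using hst
    rw [Set.mem_compl_iff, Set.mem_union, not_or] at hv
    rw [hM'.apply_eq_zero (t := t) hv.2 (by rwa [Set.piecewise_eq_of_notMem _ _ _ hv.1]),
      hM.apply_eq_zero (t := t) hv.1 (by rwa [Set.piecewise_eq_of_notMem _ _ _ hv.2]),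
      mul_zero, mul_zero]

end ActsOn

/-! ### Lattice Hamiltonians -/

theorem hasDerivAt_comp_ofReal {E : Type*} [NormedAddCommGroup E] [NormedSpace ℂ E] {f : ℂ → E}
    {f' : E} {x : ℝ} (hf : HasDerivAt f f' (x : ℂ)) : HasDerivAt (fun y : ℝ => f y) f' x := by
  simpa only [Function.comp_def, Complex.ofRealCLM_apply, Complex.ofReal_one, one_smul] using
    hf.scomp x Complex.ofRealCLM.hasDerivAt

theorem iteratedDeriv_comp_ofReal {E : Type*} [NormedAddCommGroup E] [NormedSpace ℂ E]
    {f : ℂ → E} (hf : ContDiff ℂ ⊤ f) (s : ℕ) :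
    iteratedDeriv s (fun x : ℝ => f x) = fun x : ℝ => iteratedDeriv s f x := by
  induction s with
  | zero => simp only [iteratedDeriv_zero]
  | succ s ih =>
    funext x
    rw [iteratedDeriv_succ, ih, iteratedDeriv_succ]
    exact (hasDerivAt_comp_ofReal
      (hf.differentiable_iteratedDeriv s (WithTop.coe_lt_top _) x).hasDerivAt).deriv

theorem add_one_mod_inj {N i j : ℕ} (hi : i < N) (hj : j < N)
    (hij : (i + 1) % N = (j + 1) % N) : i = j :=
  (Nat.ModEq.add_right_cancel' 1 hij).eq_of_lt_of_lt hi hj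

open Classical in
/-- The bonds that meet the bond `j`, itself included. -/
def bondNeighbors (N : ℕ) {n : ℕ} (j : Fin n) : Finset (Fin n) :=
  {i | ¬Disjoint (bond N i) (bond N j)}

theorem mem_bondNeighbors {n N : ℕ} {i j : Fin n} :
    i ∈ bondNeighbors N j ↔ ¬Disjoint (bond N i) (bond N j) := by
  simp [bondNeighbors]

theorem card_bondNeighbors_le {n N : ℕ} (hn : n ≤ N) (j : Fin n) :
    (bondNeighbors N j).card ≤ 3 := by
  classical
  set next : Finset (Fin n) := {i | (i : ℕ) = (j + 1) % N} with hnext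
  set prev : Finset (Fin n) := {i | ((i : ℕ) + 1) % N = j} with hprev
  have hsub : bondNeighbors N j ⊆ {j} ∪ next ∪ prev := by
    intro i hi
    simp only [mem_bondNeighbors, Set.not_disjoint_iff] at hi
    simp only [hnext, hprev, Finset.mem_union, Finset.mem_singleton, Finset.mem_filter_univ]
    obtain ⟨v, hvi | hvi, hvj | hvj⟩ := hi
    · exact .inl (.inl (Fin.ext (hvi.symm.trans hvj)))
    · exact .inl (.inr (hvi.symm.trans hvj))
    · exact .inr (hvi.symm.trans hvj)
    · exact .inl (.inl (Fin.ext (add_one_mod_inj (i.2.trans_le hn) (j.2.trans_le hn)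
        (hvi.symm.trans hvj))))
  have hcard_next : next.card ≤ 1 := Finset.card_le_one.2 fun i hi i' hi' => by
    rw [Finset.mem_filter_univ] at hi hi'
    exact Fin.ext (hi.trans hi'.symm)
  have hcard_prev : prev.card ≤ 1 := Finset.card_le_one.2 fun i hi i' hi' => by
    rw [Finset.mem_filter_univ] at hi hi'
    exact Fin.ext (add_one_mod_inj (i.2.trans_le hn) (i'.2.trans_le hn) (hi.trans hi'.symm))
  have hcard := (Finset.card_le_card hsub).trans (Finset.card_union_le _ _)
  have hcard' := Finset.card_union_le {j} next
  rw [Finset.card_singleton] at hcard'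
  omega

/-- The even (for `true`) or odd (for `false`) bonds. -/
def parityBonds (n : ℕ) : Bool → Finset (Fin n)
  | true => {j | Even (j : ℕ)}
  | false => {j | Odd (j : ℕ)}

theorem card_parityBonds (n : ℕ) :
    (parityBonds n true).card + (parityBonds n false).card = n := by
  have hcard := Finset.card_filter_add_card_filter_not (s := (Finset.univ : Finset (Fin n)))
    (fun j => Even (j : ℕ))
  simpa only [parityBonds, Nat.not_even_iff_odd, Finset.card_univ, Fintype.card_fin] using hcard

namespace LatticeHamiltonian

variable {n N : ℕ} (h : LatticeHamiltonian n N) (K : ℕ)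

include h in
theorem le_sites : n ≤ N := by
  rcases h.geometry with hN | ⟨hN, -⟩ <;> omega

theorem isCommutationChain_term : IsCommutationChain h.term (bondNeighbors N) where
  self_mem j := by
    rw [mem_bondNeighbors, disjoint_self]
    exact Set.Nonempty.ne_empty ⟨⟨j, j.2.trans_le h.le_sites⟩, .inl rfl⟩
  symm i j hij := by rwa [mem_bondNeighbors, disjoint_comm, ← mem_bondNeighbors]
  card_le := card_bondNeighbors_le h.le_sites
  comm i j hij :=
    (h.actsOn i).commute (h.actsOn j) (not_not.1 (mem_bondNeighbors.not.1 hij))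

theorem Lam_nonneg : 0 ≤ h.Lam := Real.iSup_nonneg fun _ => norm_nonneg _

theorem Lam1_nonneg : 0 ≤ h.Lam1 := Real.iSup_nonneg fun _ => pauliNorm_nonneg _

/-- The two layers of the formula: `A` for `true` and `B` for `false`. -/
def parts (b : Bool) : Op N := ∑ j ∈ parityBonds n b, h.term j

theorem H_eq_parts_add_parts : h.H = h.parts true + h.parts false := by
  have hsum := Finset.sum_filter_add_sum_filter_not (Finset.univ : Finset (Fin n))
    (fun j => Even (j : ℕ)) h.term
  simp only [Nat.not_even_iff_odd] at hsum
  exact hsum.symm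

theorem isHermitian_sum (E : Finset (Fin n)) : (∑ j ∈ E, h.term j).IsHermitian := by
  rw [Matrix.IsHermitian, Matrix.conjTranspose_sum]
  exact Finset.sum_congr rfl fun j _ => h.isHermitian j

theorem isHermitian_parts (b : Bool) : (h.parts b).IsHermitian := h.isHermitian_sum _

theorem isHermitian_H : h.H.IsHermitian := h.isHermitian_sum _

/-- The extension of `J_K` to complex times. -/
def gen : ℂ → Op N := layersGen h.H h.parts (trotterLayers K)

theorem differentiable_gen : Differentiable ℂ (h.gen K) := differentiable_layersGen _ _ _

theorem S_eq_layers (x : ℝ) : h.S K x = layers h.parts (trotterLayers K) (x : ℂ) :=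
  trotter_eq_layers h.parts K x

theorem conjTranspose_S (x : ℝ) : (h.S K x)ᴴ = layersInv h.parts (trotterLayers K) (x : ℂ) := by
  rw [S_eq_layers, conjTranspose_layers h.isHermitian_parts]

theorem S_mem_unitaryGroup (x : ℝ) : h.S K x ∈ Matrix.unitaryGroup (Qubits N) ℂ :=
  h.S_eq_layers K x ▸ layers_mem_unitaryGroup h.isHermitian_parts _ x

theorem V_eq_layersRem (x : ℝ) :
    h.V K x = layersRem h.H h.parts (trotterLayers K) (x : ℂ) := by
  rw [V, conjTranspose_S]
  rfl

theorem J_eq_gen : h.J K = fun x : ℝ => h.gen K (x : ℂ) := by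
  have hderiv (x : ℝ) :=
    hasDerivAt_comp_ofReal (hasDerivAt_layersInv h.parts h.H (trotterLayers K) x)
  funext x
  rw [J, R, funext (h.conjTranspose_S K), (hderiv x).deriv, conjTranspose_S,
    S_eq_layers, smul_mul_assoc, add_sub_cancel_right, ← mul_assoc, layers_mul_layersInv,
    one_mul, gen]

theorem iteratedDeriv_J (s : ℕ) :
    iteratedDeriv s (h.J K) = fun x : ℝ => iteratedDeriv s (h.gen K) (x : ℂ) := by
  rw [J_eq_gen]
  exact iteratedDeriv_comp_ofReal (h.differentiable_gen K).contDiff s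

theorem C_eq_iteratedDeriv_gen (s : ℕ) : h.C K s = iteratedDeriv s (h.gen K) 0 := by
  simp only [C, iteratedDeriv_J, Complex.ofReal_zero]

theorem conjTranspose_C (s : ℕ) : (h.C K s)ᴴ = -h.C K s := by
  suffices hskew : ∀ x : ℝ, star (iteratedDeriv s (h.J K) x) = -iteratedDeriv s (h.J K) x from
    hskew 0
  induction s with
  | zero =>
    intro x
    rw [iteratedDeriv_zero, J_eq_gen]
    exact conjTranspose_layersGen h.isHermitian_parts h.isHermitian_H _ x
  | succ s ih =>
    intro x
    have hfun : (fun x => star (iteratedDeriv s (h.J K) x)) = -iteratedDeriv s (h.J K) :=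
      funext ih
    rw [iteratedDeriv_succ, ← deriv.star, hfun, deriv.neg]

variable {K} (hK : IsTrotterOrder K)
include hK

theorem C_eq_zero {s : ℕ} (hs : s < K) : h.C K s = 0 := by
  obtain ⟨R, hR⟩ := exists_approxEvol_trotterLayers h.parts hK
  rw [C_eq_iteratedDeriv_gen]
  exact (h.H_eq_parts_add_parts ▸ hR).iteratedDeriv_layersGen_eq_zero hs

theorem seminorm_C_le {ν : Seminorm ℂ (Op N)} (hν : ∀ X Y, ν (X * Y) ≤ ν X * ν Y) {Λ : ℝ}
    (hΛ0 : 0 ≤ Λ) (hΛ : ∀ j, ν (h.term j) ≤ Λ) (s : ℕ) :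
    ν (h.C K s) ≤ n * (1 + trotterWeight K) * Λ * (4 * trotterWeight K * Λ) ^ s *
      ((s + 2).factorial / 2) := by
  have hcard : ((parityBonds n true).card : ℝ) + (parityBonds n false).card = n := by
    exact_mod_cast card_parityBonds n
  have hgrowth := seminorm_iteratedDeriv_layersGen_le h.isCommutationChain_term hν hΛ hΛ0
    (parityBonds n) Finset.univ (trotterLayers K) s
  rw [layerLength_trotterLayers _ hK, layerLength_trotterLayers _ hK, hcard, Finset.card_univ,
    Fintype.card_fin, Pi.one_apply, Pi.one_apply] at hgrowth
  rw [C_eq_iteratedDeriv_gen]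
  refine hgrowth.trans_eq ?_
  ring

theorem norm_C_le (s : ℕ) :
    ‖h.C K s‖ ≤ n * (1 + trotterWeight K) * h.Lam * (4 * trotterWeight K * h.Lam) ^ s *
      ((s + 2).factorial / 2) :=
  h.seminorm_C_le hK (ν := normSeminorm ℂ (Op N)) norm_mul_le
    h.Lam_nonneg
    (le_ciSup (f := fun j => ‖h.term j‖) (Set.finite_range _).bddAbove) s

theorem pauliNorm_C_le (s : ℕ) :
    pauliNorm (h.C K s) ≤ n * (1 + trotterWeight K) * h.Lam1 *
      (4 * trotterWeight K * h.Lam1) ^ s * ((s + 2).factorial / 2) :=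
  h.seminorm_C_le hK (ν := pauliSeminorm N) pauliNorm_mul_le
    h.Lam1_nonneg
    (le_ciSup (f := fun j => pauliNorm (h.term j)) (Set.finite_range _).bddAbove) s

end LatticeHamiltonian

/-! ### The truncation error -/

section Duhamel

theorem norm_le_of_hasDerivAt_of_norm_le_pow {E : Type*} [NormedAddCommGroup E] [NormedSpace ℝ E]
    {f f' : ℝ → E} {D x : ℝ} {m : ℕ} (hf0 : f 0 = 0) (hf : ∀ t, HasDerivAt f (f' t) t)
    (hbound : ∀ t ∈ Set.Icc 0 x, ‖f' t‖ ≤ D * t ^ m) {t : ℝ} (ht : t ∈ Set.Icc 0 x) :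
    ‖f t‖ ≤ D / (m + 1) * t ^ (m + 1) := by
  refine image_norm_le_of_norm_deriv_right_le_deriv_boundary (f' := f')
    (B := fun t => D / (m + 1) * t ^ (m + 1)) (B' := fun t => D * t ^ m)
    (fun t _ => (hf t).continuousAt.continuousWithinAt) (fun t _ => (hf t).hasDerivWithinAt)
    (by simp [hf0]) (fun t => ?_) (fun t ht => hbound t (Set.Ico_subset_Icc_self ht)) ht
  refine ((hasDerivAt_pow (m + 1) t).const_mul (D / (m + 1))).congr_deriv ?_
  push_cast
  field_simp

variable {𝒜 : Type*} [NormedRing 𝒜] [NormedAlgebra ℝ 𝒜] {V J : ℝ → 𝒜} {D x : ℝ} {K : ℕ}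
  (hV0 : V 0 = 1) (hV : ∀ t, HasDerivAt V (V t * J t) t) (hV1 : ∀ t, ‖V t‖ ≤ 1)
  (hJ : ∀ t ∈ Set.Icc 0 x, ‖J t‖ ≤ D * t ^ K)
include hV0 hV hV1 hJ

theorem norm_sub_one_le_of_hasDerivAt_mul {t : ℝ} (ht : t ∈ Set.Icc 0 x) :
    ‖V t - 1‖ ≤ D / (K + 1) * t ^ (K + 1) := by
  refine norm_le_of_hasDerivAt_of_norm_le_pow (f := fun t => V t - 1) (by rw [hV0, sub_self])
    (fun t => (hV t).sub_const 1) (fun t ht => ?_) ht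
  calc ‖V t * J t‖ ≤ ‖V t‖ * ‖J t‖ := norm_mul_le _ _
    _ ≤ ‖J t‖ := mul_le_of_le_one_left (norm_nonneg _) (hV1 t)
    _ ≤ D * t ^ K := hJ t ht

/- The derivative of `V - W` is `(V - 1) J + (J - G)`: both factors of the first summand are small,
so dropping it costs only twice the order of `J`. -/
theorem norm_sub_le_of_hasDerivAt_mul {W G : ℝ → 𝒜} {D' : ℝ} (hW0 : W 0 = 1)
    (hW : ∀ t, HasDerivAt W (G t) t)
    (hJG : ∀ t ∈ Set.Icc 0 x, ‖J t - G t‖ ≤ D' * t ^ (2 * K + 1)) {t : ℝ}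
    (ht : t ∈ Set.Icc 0 x) :
    ‖V t - W t‖ ≤ (D ^ 2 / (K + 1) + D') / (2 * K + 2) * t ^ (2 * K + 2) := by
  have hderiv (t : ℝ) : HasDerivAt (fun t => V t - W t) ((V t - 1) * J t + (J t - G t)) t :=
    ((hV t).sub (hW t)).congr_deriv (by noncomm_ring)
  have hbound := norm_le_of_hasDerivAt_of_norm_le_pow (m := 2 * K + 1) (x := x)
    (D := D ^ 2 / (K + 1) + D') (by rw [hV0, hW0, sub_self]) hderiv (fun t ht => ?_) ht
  · refine hbound.trans_eq ?_
    push_cast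
    ring
  have hV_sub := norm_sub_one_le_of_hasDerivAt_mul hV0 hV hV1 hJ ht
  calc ‖(V t - 1) * J t + (J t - G t)‖ ≤ ‖V t - 1‖ * ‖J t‖ + ‖J t - G t‖ :=
      (norm_add_le _ _).trans (by gcongr; exact norm_mul_le _ _)
    _ ≤ D / (K + 1) * t ^ (K + 1) * (D * t ^ K) + D' * t ^ (2 * K + 1) :=
      add_le_add (mul_le_mul hV_sub (hJ t ht) (norm_nonneg _) ((norm_nonneg _).trans hV_sub))
        (hJG t ht)
    _ = (D ^ 2 / (K + 1) + D') * t ^ (2 * K + 1) := by ring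

end Duhamel

/-- The sum of the series `∑ j, (j + m + 2).choose 2 * θ ^ j`. -/
def geomTail (m : ℕ) (θ : ℝ) : ℝ :=
  1 / (1 - θ) ^ 3 + m * (1 / (1 - θ) ^ 2) + m * (m + 1) / 2 * (1 / (1 - θ))

theorem hasSum_geomTail (m : ℕ) {θ : ℝ} (hθ0 : 0 ≤ θ) (hθ1 : θ < 1) :
    HasSum (fun j : ℕ => ((j + m + 2 : ℝ) * (j + m + 1) / 2) * θ ^ j) (geomTail m θ) := by
  have hθ : ‖θ‖ < 1 := by rwa [Real.norm_of_nonneg hθ0]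
  have hsum := ((hasSum_choose_mul_geometric_of_norm_lt_one 2 hθ).add
    ((hasSum_choose_mul_geometric_of_norm_lt_one 1 hθ).mul_left (m : ℝ))).add
    ((hasSum_geometric_of_lt_one hθ0 hθ1).mul_left ((m : ℝ) * (m + 1) / 2))
  rw [← one_div] at hsum
  refine hsum.congr_fun fun j => ?_
  rw [Nat.cast_choose_two, Nat.choose_one_right]
  push_cast
  ring

namespace LatticeHamiltonian

variable {n N : ℕ} (h : LatticeHamiltonian n N) (K : ℕ)

theorem norm_V (t : ℝ) : ‖h.V K t‖ = 1 :=
  CStarRing.norm_of_mem_unitary (mul_mem (expI_mem_unitaryGroup h.isHermitian_H t)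
    (Unitary.star_mem (h.S_mem_unitaryGroup K t)))

theorem V_zero : h.V K 0 = 1 := by
  rw [V_eq_layersRem, layersRem, layersInv, Complex.ofReal_zero, neg_zero, expI_zero,
    layers_apply_zero, one_mul]

theorem hasDerivAt_V (t : ℝ) : HasDerivAt (h.V K) (h.V K t * h.gen K t) t := by
  rw [funext (h.V_eq_layersRem K)]
  exact hasDerivAt_comp_ofReal (hasDerivAt_layersRem h.parts h.H (trotterLayers K) t)

/-- The Taylor polynomial of `J_K` at `0` with `m` terms. -/
def genTaylor (m : ℕ) (t : ℝ) : Op N :=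
  ∑ s ∈ Finset.range m, ((t ^ s / s.factorial : ℝ) : ℂ) • h.C K s

theorem hasSum_gen (t : ℝ) :
    HasSum (fun s : ℕ => ((t ^ s / s.factorial : ℝ) : ℂ) • h.C K s) (h.gen K t) := by
  refine (Complex.hasSum_taylorSeries_of_entire (h.differentiable_gen K) 0 (t : ℂ)).congr_fun
    fun s => ?_
  rw [C_eq_iteratedDeriv_gen, sub_zero, smul_smul]
  congr 1
  push_cast
  ring

/-- The constant in the bound `O(t ^ m)`, valid on `[0, x]`, for the error of the Taylor polynomial
of `J_K` with `m` terms. -/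
def taylorErrorConst (m : ℕ) (x : ℝ) : ℝ :=
  n * (1 + trotterWeight K) * h.Lam * (4 * trotterWeight K * h.Lam) ^ m *
    geomTail m (4 * trotterWeight K * h.Lam * x)

variable {K} (hK : IsTrotterOrder K)
include hK

theorem norm_gen_sub_genTaylor_le {x t : ℝ} (ht : t ∈ Set.Icc 0 x)
    (hx : 4 * trotterWeight K * h.Lam * x < 1) (m : ℕ) :
    ‖h.gen K t - h.genTaylor K m t‖ ≤ h.taylorErrorConst K m x * t ^ m := by
  obtain ⟨ht0, htx⟩ := ht
  have hw := trotterWeight_pos K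
  have hΛ := h.Lam_nonneg
  rw [taylorErrorConst]
  set p := 4 * trotterWeight K * h.Lam
  have hp0 : 0 ≤ p := by positivity
  have hgeom := (hasSum_geomTail m (mul_nonneg hp0 (ht0.trans htx)) hx).mul_left
    (n * (1 + trotterWeight K) * h.Lam * p ^ m * t ^ m)
  rw [genTaylor, ← ((hasSum_nat_add_iff' m).2 (h.hasSum_gen K t)).tsum_eq]
  refine (tsum_of_norm_bounded hgeom fun j => ?_).trans_eq (by ring)
  rw [norm_smul, Complex.norm_real, Real.norm_of_nonneg (by positivity)]
  calc t ^ (j + m) / (j + m).factorial * ‖h.C K (j + m)‖ ≤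
      t ^ (j + m) / (j + m).factorial * (n * (1 + trotterWeight K) * h.Lam * p ^ (j + m) *
        ((j + m + 2).factorial / 2)) := by gcongr; exact h.norm_C_le hK (j + m)
    _ = n * (1 + trotterWeight K) * h.Lam * p ^ m * t ^ m *
        ((j + m + 2 : ℝ) * (j + m + 1) / 2 * (p * t) ^ j) := by
      rw [Nat.factorial_succ, Nat.factorial_succ]
      push_cast
      field_simp
      ring
    _ ≤ n * (1 + trotterWeight K) * h.Lam * p ^ m * t ^ m *
        ((j + m + 2 : ℝ) * (j + m + 1) / 2 * (p * x) ^ j) := by gcongr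

theorem genTaylor_eq_zero (t : ℝ) : h.genTaylor K K t = 0 :=
  Finset.sum_eq_zero fun s hs => by
    rw [h.C_eq_zero hK (Finset.mem_range.1 hs), smul_zero]

theorem Vtilde_eq (x : ℝ) :
    h.Vtilde K x = 1 + ∑ s ∈ Finset.range (2 * K + 1),
      ((x ^ (s + 1) / (s + 1).factorial : ℝ) : ℂ) • h.C K s := by
  have hlow : ∑ s ∈ Finset.range K, ((x ^ (s + 1) / (s + 1).factorial : ℝ) : ℂ) • h.C K s = 0 :=
    Finset.sum_eq_zero fun s hs => by
      rw [h.C_eq_zero hK (Finset.mem_range.1 hs), smul_zero]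
  rw [Vtilde, ← Finset.sum_range_add_sum_Ico _ (show K ≤ 2 * K + 1 by omega), hlow, zero_add,
    ← Finset.Ico_add_one_right_eq_Icc, ← Finset.sum_Ico_add' (fun s => h.F K s x)]
  rfl

theorem hasDerivAt_Vtilde (t : ℝ) :
    HasDerivAt (h.Vtilde K) (h.genTaylor K (2 * K + 1) t) t := by
  rw [funext (h.Vtilde_eq hK)]
  refine (HasDerivAt.fun_sum fun s _ => HasDerivAt.smul_const ?_ _).const_add 1
  refine (((hasDerivAt_pow (s + 1) t).div_const _).congr_deriv ?_).ofReal_comp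
  rw [Nat.factorial_succ]
  push_cast
  field_simp

theorem eps_le_taylorErrorConst {x : ℝ} (hx0 : 0 ≤ x)
    (hx : 4 * trotterWeight K * h.Lam * x < 1) :
    h.eps K x ≤ (h.taylorErrorConst K K x ^ 2 / (K + 1) + h.taylorErrorConst K (2 * K + 1) x) /
      (2 * K + 2) * x ^ (2 * K + 2) := by
  rw [eps, norm_sub_rev]
  refine norm_sub_le_of_hasDerivAt_mul (h.V_zero K) (h.hasDerivAt_V K)
    (fun t => (h.norm_V K t).le) (fun t ht => ?_) ?_ (h.hasDerivAt_Vtilde hK)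
    (fun t ht => h.norm_gen_sub_genTaylor_le hK ht hx _) ⟨hx0, le_rfl⟩
  · simpa only [h.genTaylor_eq_zero hK, sub_zero] using h.norm_gen_sub_genTaylor_le hK ht hx K
  · simp [h.Vtilde_eq hK]

end LatticeHamiltonian

/-! ### Numerical estimates -/

theorem IsTrotterOrder.cases {K : ℕ} (hK : IsTrotterOrder K) :
    K = 1 ∨ K = 2 ∨ ∃ k, 1 ≤ k ∧ K = 2 * (k + 1) := by
  rcases hK with rfl | ⟨k, hk, rfl⟩
  · exact .inl rfl
  · obtain rfl | hk' := hk.eq_or_lt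
    · exact .inr (.inl rfl)
    · exact .inr (.inr ⟨k - 1, by omega, by omega⟩)

/-- The paper's `β`, the growth rate of the error terms of a formula with `κ` stages. -/
def beta (κ : ℕ) : ℝ := 2 * (4 * κ + 5)

theorem beta_pos (κ : ℕ) : 0 < beta κ := by
  rw [beta]
  positivity

theorem le_beta {κ m : ℕ} (hm : m ≤ κ) : 8 * (m : ℝ) + 10 ≤ beta κ := by
  have hm' : (m : ℝ) ≤ κ := by exact_mod_cast hm
  rw [beta]
  linarith

theorem geomTail_mono (m : ℕ) {θ c : ℝ} (hθ : θ ≤ c) (hc : c < 1) :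
    geomTail m θ ≤ geomTail m c := by
  have : 0 < 1 - c := sub_pos.2 hc
  have hcθ := sub_le_sub_left hθ 1
  rw [geomTail, geomTail]
  gcongr

theorem geomTail_nonneg (m : ℕ) {θ : ℝ} (hθ : θ < 1) : 0 ≤ geomTail m θ := by
  have : 0 < 1 - θ := sub_pos.2 hθ
  rw [geomTail]
  positivity

theorem geomTail_le {m : ℕ} (hm : 4 ≤ m) : geomTail m (81 / 100) ≤ 11 * (m + 1) * (m + 2) := by
  have hm' : (4 : ℝ) ≤ m := by exact_mod_cast hm
  rw [geomTail]
  norm_num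
  nlinarith

/-- The factor of `n ^ 2 * (Λ * x) ^ (2 * K + 2)` in the bound for the truncation error, for a
formula of total stage length `w` and a time at which `4 * w * Λ * x ≤ c`. -/
def truncationConst (K : ℕ) (w c : ℝ) : ℝ :=
  ((1 + w) ^ 2 * (4 * w) ^ (2 * K) * geomTail K c ^ 2 / (K + 1) +
    (1 + w) * (4 * w) ^ (2 * K + 1) * geomTail (2 * K + 1) c) / (2 * K + 2)

theorem factorial_le_half_pow (K : ℕ) : (K.factorial : ℝ) ≤ ((K + 1) / 2) ^ K := by
  induction K with
  | zero => simp
  | succ K ih =>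
    have hbernoulli := one_add_mul_le_pow (a := 1 / ((K : ℝ) + 1))
      (le_trans (by norm_num) (by positivity : 0 ≤ 1 / ((K : ℝ) + 1))) (K + 1)
    have htwo : (2 : ℝ) ≤ (1 + 1 / (K + 1)) ^ (K + 1) := by
      push_cast at hbernoulli
      rw [mul_one_div_cancel (by positivity)] at hbernoulli
      linarith
    rw [Nat.factorial_succ]
    push_cast
    calc ((K : ℝ) + 1) * K.factorial ≤ (K + 1) * ((K + 1) / 2) ^ K := by gcongr
      _ = 2 * ((K + 1) / 2) ^ (K + 1) := by rw [pow_succ]; ring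
      _ ≤ (1 + 1 / (K + 1)) ^ (K + 1) * ((K + 1) / 2) ^ (K + 1) := by gcongr
      _ = ((K + 1 + 1) / 2) ^ (K + 1) := by
        rw [← mul_pow]; congr 1; field_simp

theorem cubic_le_six_pow {K : ℕ} (hK : 4 ≤ K) : 7 * (K + 2) ^ 2 * (K + 1) ≤ 6 ^ K := by
  induction K, hK using Nat.le_induction with
  | base => norm_num
  | succ K hK ih =>
    rw [pow_succ 6 K]
    nlinarith [Nat.mul_le_mul hK hK, Nat.mul_le_mul (Nat.mul_le_mul hK hK) hK]

theorem sq_le_two_pow {K : ℕ} (hK : 4 ≤ K) : (K + 1) ^ 2 ≤ 2 * 2 ^ K := by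
  induction K, hK using Nat.le_induction with
  | base => norm_num
  | succ K hK ih => rw [pow_succ 2 K]; nlinarith

section HighOrder

variable {K κ : ℕ} {w : ℝ} (hK : 4 ≤ K) (hκ : 6 ≤ κ) (hw : 0 < w) (hwκ : 1 + w ≤ κ)
  (hwβ : 4 * w * (K + 1) ≤ 81 / 100 * beta κ)

include hw hwβ in
theorem factorial_mul_pow_le :
    K.factorial * (4 * w) ^ K ≤ (81 / 200 * beta κ) ^ K := by
  calc K.factorial * (4 * w) ^ K ≤ ((K + 1) / 2) ^ K * (4 * w) ^ K := by
        gcongr; exact factorial_le_half_pow K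
    _ = (4 * w * (K + 1) / 2) ^ K := by rw [← mul_pow]; congr 1; ring
    _ ≤ (81 / 200 * beta κ) ^ K := by gcongr; linarith

include hw hwβ in
theorem six_pow_mul_factorial_mul_pow_sq_le :
    6 ^ K * (K.factorial * (4 * w) ^ K) ^ 2 ≤ beta κ ^ (2 * K) := by
  have hβ := beta_pos κ
  calc 6 ^ K * (K.factorial * (4 * w) ^ K) ^ 2
      ≤ 6 ^ K * ((81 / 200 * beta κ) ^ K) ^ 2 := by gcongr; exact factorial_mul_pow_le hw hwβ
    _ = (6 * (81 / 200) ^ 2) ^ K * beta κ ^ (2 * K) := by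
      rw [pow_mul (beta κ), ← pow_mul, mul_comm K 2, pow_mul, ← mul_pow, ← mul_pow]; ring
    _ ≤ 1 * beta κ ^ (2 * K) := by gcongr; exact pow_le_one₀ (by norm_num) (by norm_num)
    _ = beta κ ^ (2 * K) := one_mul _

include hK hw hwβ in
theorem four_mul_geomTail_le :
    4 * w * (geomTail (2 * K + 1) (81 / 100) / 2) ≤
      9 / 7 * beta κ * (7 * (K + 2) ^ 2 * (K + 1)) := by
  have hK' : (4 : ℝ) ≤ K := by exact_mod_cast hK
  have hβ := beta_pos κ
  have htail := geomTail_le (m := 2 * K + 1) (by omega)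
  push_cast at htail
  calc 4 * w * (geomTail (2 * K + 1) (81 / 100) / 2)
      ≤ 4 * w * (11 * (2 * K + 1 + 1) * (2 * K + 1 + 2) / 2) := by gcongr
    _ = 11 * (2 * K + 3) * (4 * w * (K + 1)) := by ring
    _ ≤ 11 * (2 * K + 3) * (81 / 100 * beta κ) := by gcongr
    _ ≤ 9 * beta κ * (2 * K + 3) := by nlinarith
    _ ≤ 9 * beta κ * ((K + 2) ^ 2 * (K + 1)) := by gcongr; nlinarith
    _ = 9 / 7 * beta κ * (7 * (K + 2) ^ 2 * (K + 1)) := by ring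

include hK hκ hw hwκ hwβ in
theorem truncation_factor_le :
    (1 + w) ^ 2 * (geomTail K (81 / 100) ^ 2 / (2 * (K + 1))) +
      (1 + w) * (4 * w * (geomTail (2 * K + 1) (81 / 100) / 2)) ≤ κ ^ 2 * beta κ * 6 ^ K := by
  have hκ' : (6 : ℝ) ≤ κ := by exact_mod_cast hκ
  have hβ : 58 ≤ beta κ := by simpa using (le_beta hκ).trans' (by norm_num)
  have hQ : (7 : ℝ) * (K + 2) ^ 2 * (K + 1) ≤ 6 ^ K := by exact_mod_cast cubic_le_six_pow hK
  have htail : geomTail K (81 / 100) ^ 2 / (2 * (K + 1)) ≤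
      121 / 14 * (7 * (K + 2) ^ 2 * (K + 1)) := by
    have htail_nonneg := geomTail_nonneg K (show (81 / 100 : ℝ) < 1 by norm_num)
    rw [div_le_iff₀ (by positivity)]
    calc geomTail K (81 / 100) ^ 2 ≤ (11 * (K + 1) * (K + 2) : ℝ) ^ 2 := by
          gcongr; exact geomTail_le hK
      _ = 121 / 14 * (7 * (K + 2) ^ 2 * (K + 1)) * (2 * (K + 1) : ℝ) := by ring
  have hβtail := four_mul_geomTail_le hK hw hwβ
  have hβtail_nonneg : 0 ≤ 4 * w * (geomTail (2 * K + 1) (81 / 100) / 2) :=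
    mul_nonneg (by positivity) (div_nonneg (geomTail_nonneg _ (by norm_num)) zero_le_two)
  have hκβ : 121 / 14 * (κ : ℝ) ^ 2 + 9 / 7 * κ * beta κ ≤ κ ^ 2 * beta κ := by
    nlinarith [mul_nonneg (mul_nonneg κ.cast_nonneg (beta_pos κ).le) (sub_nonneg.2 hκ'),
      mul_nonneg (sq_nonneg (κ : ℝ)) (sub_nonneg.2 hβ)]
  set Q : ℝ := 7 * (K + 2) ^ 2 * (K + 1)
  set T := 4 * w * (geomTail (2 * K + 1) (81 / 100) / 2)
  calc (1 + w) ^ 2 * (geomTail K (81 / 100) ^ 2 / (2 * (K + 1))) + (1 + w) * T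
      ≤ (κ : ℝ) ^ 2 * (121 / 14 * Q) + κ * (9 / 7 * beta κ * Q) := by gcongr
    _ = (121 / 14 * (κ : ℝ) ^ 2 + 9 / 7 * κ * beta κ) * Q := by ring
    _ ≤ κ ^ 2 * beta κ * 6 ^ K := by gcongr

include hK hκ hw hwκ hwβ in
theorem truncationConst_le :
    truncationConst K w (81 / 100) ≤
      κ ^ 2 * beta κ ^ (2 * K + 1) / (K.factorial * (K + 1).factorial) := by
  have hβ := beta_pos κ
  rw [le_div_iff₀ (by positivity), truncationConst, Nat.factorial_succ]
  push_cast
  calc _ = ((1 + w) ^ 2 * (geomTail K (81 / 100) ^ 2 / (2 * (K + 1))) +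
        (1 + w) * (4 * w * (geomTail (2 * K + 1) (81 / 100) / 2))) *
          (K.factorial * (4 * w) ^ K) ^ 2 := by
        rw [pow_succ (4 * w), mul_comm 2 K, pow_mul]
        field_simp
    _ ≤ κ ^ 2 * beta κ * 6 ^ K * (K.factorial * (4 * w) ^ K) ^ 2 := by
      gcongr; exact truncation_factor_le hK hκ hw hwκ hwβ
    _ = κ ^ 2 * beta κ * (6 ^ K * (K.factorial * (4 * w) ^ K) ^ 2) := by ring
    _ ≤ κ ^ 2 * beta κ * beta κ ^ (2 * K) := by
      gcongr; exact six_pow_mul_factorial_mul_pow_sq_le hw hwβ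
    _ = κ ^ 2 * beta κ ^ (2 * K + 1) := by ring

include hK hw hwκ hwβ in
theorem etaSum_const_le :
    (1 + w) * (K + 1) ^ 2 * (4 * w) ^ K ≤ κ * beta κ ^ (K + 1) / K.factorial := by
  have hβ := beta_pos κ
  have hβ2 : 2 ≤ beta κ := by simpa using (le_beta κ.zero_le).trans' (by norm_num)
  have hpow : ((K : ℝ) + 1) ^ 2 * (1 / 2) ^ K ≤ 2 := by
    rw [one_div, inv_pow, ← div_eq_mul_inv, div_le_iff₀ (by positivity)]
    exact_mod_cast sq_le_two_pow hK
  rw [le_div_iff₀ (by positivity)]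
  calc (1 + w) * (K + 1) ^ 2 * (4 * w) ^ K * K.factorial
      = (1 + w) * (K + 1) ^ 2 * (K.factorial * (4 * w) ^ K) := by ring
    _ ≤ κ * (K + 1) ^ 2 * (81 / 200 * beta κ) ^ K := by
      gcongr; exact factorial_mul_pow_le hw hwβ
    _ ≤ κ * (K + 1) ^ 2 * (1 / 2 * beta κ) ^ K := by
      have hhalf : 81 / 200 * beta κ ≤ 1 / 2 * beta κ := by linarith
      gcongr
    _ = κ * beta κ ^ K * ((K + 1) ^ 2 * (1 / 2) ^ K) := by rw [mul_pow]; ring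
    _ ≤ κ * beta κ ^ K * beta κ := by gcongr; exact hpow.trans hβ2
    _ = κ * beta κ ^ (K + 1) := by ring

end HighOrder

section StageForm

variable {κ : ℕ} {a b : Fin κ → ℝ}

theorem four_mul_pow_mul_le {k : ℕ} (hk : 1 ≤ k) :
    4 * (7 / 3 : ℝ) ^ k * (2 * k + 3) ≤ 81 / 100 * (8 * 5 ^ k + 18) := by
  induction k, hk using Nat.le_induction with
  | base => norm_num
  | succ k hk ih =>
    have hk' : (1 : ℝ) ≤ k := by exact_mod_cast hk
    have hfive : (5 : ℝ) ≤ 5 ^ k := le_self_pow₀ (by norm_num) (by omega)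
    have hstep : 2 * ((k : ℝ) + 1) + 3 ≤ 7 / 5 * (2 * k + 3) := by linarith
    push_cast
    calc 4 * (7 / 3 : ℝ) ^ (k + 1) * (2 * (k + 1) + 3)
        ≤ 4 * (7 / 3 : ℝ) ^ (k + 1) * (7 / 5 * (2 * k + 3)) := by gcongr
      _ = 49 / 15 * (4 * (7 / 3 : ℝ) ^ k * (2 * k + 3)) := by ring
      _ ≤ 81 / 100 * (8 * 5 ^ (k + 1) + 18) := by rw [pow_succ (5 : ℝ)]; linarith

theorem IsStageForm.six_le {k : ℕ} (hk : 1 ≤ k) (hstage : IsStageForm (2 * (k + 1)) a b) :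
    6 ≤ κ := by
  have hpow := Nat.pow_le_pow_right (show 0 < 5 by norm_num) hk
  have hκ := five_pow_lt_of_isStageForm hstage
  omega

theorem IsStageForm.one_add_trotterWeight_le {k : ℕ} (hstage : IsStageForm (2 * (k + 1)) a b) :
    1 + trotterWeight (2 * (k + 1)) ≤ κ := by
  have hκ : (5 : ℝ) ^ k + 1 ≤ κ := by exact_mod_cast five_pow_lt_of_isStageForm hstage
  have hpow : (7 / 3 : ℝ) ^ k ≤ 5 ^ k := by gcongr; norm_num
  rw [trotterWeight_two_mul_succ]
  linarith [suzukiWeight_le k]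

theorem IsStageForm.four_mul_trotterWeight_mul_le {k : ℕ} (hk : 1 ≤ k)
    (hstage : IsStageForm (2 * (k + 1)) a b) :
    4 * trotterWeight (2 * (k + 1)) * ((2 * (k + 1) : ℕ) + 1) ≤ 81 / 100 * beta κ := by
  have hκ := le_beta (five_pow_lt_of_isStageForm hstage)
  push_cast at hκ ⊢
  rw [trotterWeight_two_mul_succ]
  calc 4 * suzukiWeight k * (2 * (k + 1) + 1) ≤ 4 * (7 / 3 : ℝ) ^ k * (2 * (k + 1) + 1) := by
        gcongr; exact suzukiWeight_le k
    _ = 4 * (7 / 3 : ℝ) ^ k * (2 * k + 3) := by ring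
    _ ≤ 81 / 100 * (8 * 5 ^ k + 18) := four_mul_pow_mul_le hk
    _ ≤ 81 / 100 * beta κ := by linarith

theorem trotterWeight_two : trotterWeight 2 = 1 := trotterWeight_two_mul_succ 0

theorem IsStageForm.two_le (hstage : IsStageForm 2 a b) : 2 ≤ κ :=
  five_pow_lt_of_isStageForm (k := 0) hstage

variable {K : ℕ} (hK : IsTrotterOrder K) (hstage : IsStageForm K a b)
include hK hstage

theorem exists_truncationConst_le :
    ∃ c < 1, 0 ≤ c ∧ 4 * trotterWeight K * (K + 1) ≤ c * beta κ ∧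
      truncationConst K (trotterWeight K) c ≤
        κ ^ 2 * beta κ ^ (2 * K + 1) / (K.factorial * (K + 1).factorial) := by
  rcases hK.cases with rfl | rfl | ⟨k, hk, rfl⟩
  · have hκ := one_le_of_isStageForm_one hstage
    have hβ : 18 ≤ beta κ := (le_beta hκ).trans' (by norm_num)
    have hκβ : (1 : ℝ) ^ 2 * 18 ^ 3 ≤ (κ : ℝ) ^ 2 * beta κ ^ 3 := by gcongr; exact_mod_cast hκ
    refine ⟨4 / 9, by norm_num, by norm_num, ?_, ?_⟩ <;> rw [trotterWeight_one]
    · push_cast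
      linarith
    · norm_num [truncationConst, geomTail, Nat.factorial] at hκβ ⊢
      linarith
  · have hκ := hstage.two_le
    have hβ : 26 ≤ beta κ := (le_beta hκ).trans' (by norm_num)
    have hκβ : (2 : ℝ) ^ 2 * 26 ^ 5 ≤ (κ : ℝ) ^ 2 * beta κ ^ 5 := by gcongr; exact_mod_cast hκ
    refine ⟨6 / 13, by norm_num, by norm_num, ?_, ?_⟩ <;> rw [trotterWeight_two]
    · push_cast
      linarith
    · norm_num [truncationConst, geomTail, Nat.factorial] at hκβ ⊢
      linarith
  · exact ⟨81 / 100, by norm_num, by norm_num, hstage.four_mul_trotterWeight_mul_le hk,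
      truncationConst_le (by omega) (hstage.six_le hk) (trotterWeight_pos _)
        hstage.one_add_trotterWeight_le (hstage.four_mul_trotterWeight_mul_le hk)⟩

theorem four_mul_trotterWeight_mul_le_beta : 4 * trotterWeight K * (K + 2) ≤ beta κ := by
  rcases hK.cases with rfl | rfl | ⟨k, hk, rfl⟩
  · have hβ := le_beta (one_le_of_isStageForm_one hstage)
    rw [trotterWeight_one]
    push_cast at hβ ⊢
    linarith
  · have hβ := le_beta hstage.two_le
    rw [trotterWeight_two]
    push_cast at hβ ⊢
    linarith
  · have hβ := hstage.four_mul_trotterWeight_mul_le hk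
    have hw := trotterWeight_pos (2 * (k + 1))
    push_cast at hβ ⊢
    have hk' : (1 : ℝ) ≤ k := by exact_mod_cast hk
    nlinarith

theorem etaSum_const_le_beta :
    (1 + trotterWeight K) * (K + 1) ^ 2 * (4 * trotterWeight K) ^ K ≤
      κ * beta κ ^ (K + 1) / K.factorial := by
  rcases hK.cases with rfl | rfl | ⟨k, hk, rfl⟩
  · have hκ := one_le_of_isStageForm_one hstage
    have hβ : 18 ≤ beta κ := (le_beta hκ).trans' (by norm_num)
    have hκβ : (1 : ℝ) * 18 ^ 2 ≤ κ * beta κ ^ 2 := by gcongr; exact_mod_cast hκ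
    rw [trotterWeight_one]
    norm_num [Nat.factorial] at hκβ ⊢
    linarith
  · have hκ := hstage.two_le
    have hβ : 26 ≤ beta κ := (le_beta hκ).trans' (by norm_num)
    have hκβ : (2 : ℝ) * 26 ^ 3 ≤ κ * beta κ ^ 3 := by gcongr; exact_mod_cast hκ
    rw [trotterWeight_two]
    norm_num [Nat.factorial] at hκβ ⊢
    linarith
  · exact etaSum_const_le (by omega) (trotterWeight_pos _) hstage.one_add_trotterWeight_le
      (hstage.four_mul_trotterWeight_mul_le hk)

end StageForm

/-! ### The bounds for `ε_K` and `μ_K` -/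

theorem mul_le_of_mul_lt {w β y k c : ℝ} (hy : 0 ≤ y) (hk : 0 < k) (hc : 0 ≤ c)
    (hβ : β * y < k) (hw : w * k ≤ c * β) : w * y ≤ c := by
  refine le_of_mul_le_mul_right ?_ hk
  calc w * y * k = w * k * y := by ring
    _ ≤ c * β * y := by gcongr
    _ = c * (β * y) := by ring
    _ ≤ c * k := by gcongr

theorem sqrt_one_add_sq_le_exp (η : ℝ) : √(1 + η ^ 2) ≤ Real.exp (η ^ 2 / 2) :=
  calc √(1 + η ^ 2) ≤ 1 + η ^ 2 / 2 := Real.sqrt_one_add_le (by nlinarith [sq_nonneg η])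
    _ ≤ Real.exp (η ^ 2 / 2) := by rw [add_comm]; exact Real.add_one_le_exp _

namespace LatticeHamiltonian

variable {n N : ℕ} (h : LatticeHamiltonian n N) {K κ : ℕ} {a b : Fin κ → ℝ} {x : ℝ}

theorem eta_nonneg (s : ℕ) (hx : 0 ≤ x) : 0 ≤ h.eta K s x :=
  mul_nonneg (pauliNorm_nonneg _) (by positivity)

theorem etaSum_nonneg (hx : 0 ≤ x) : 0 ≤ h.etaSum K x :=
  Finset.sum_nonneg fun s _ => h.eta_nonneg s hx

variable (hK : IsTrotterOrder K)
include hK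

theorem eps_le_truncationConst (hx0 : 0 ≤ x) {c : ℝ} (hc : c < 1)
    (hx : 4 * trotterWeight K * h.Lam * x ≤ c) :
    h.eps K x ≤ n ^ 2 * truncationConst K (trotterWeight K) c * (h.Lam * x) ^ (2 * K + 2) := by
  refine (h.eps_le_taylorErrorConst hK hx0 (hx.trans_lt hc)).trans ?_
  have hw := trotterWeight_pos K
  have hΛ := h.Lam_nonneg
  have hn : (n : ℝ) ≤ (n : ℝ) ^ 2 := by exact_mod_cast Nat.le_self_pow two_ne_zero n
  have htail_nonneg (m : ℕ) := geomTail_nonneg m (hx.trans_lt hc)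
  have htail (m : ℕ) := geomTail_mono m hx hc
  rw [taylorErrorConst, taylorErrorConst]
  set w := trotterWeight K
  set θ := 4 * w * h.Lam * x
  calc _ = (n ^ 2 * ((1 + w) ^ 2 * (4 * w) ^ (2 * K) * geomTail K θ ^ 2 / (K + 1)) +
        n * ((1 + w) * (4 * w) ^ (2 * K + 1) * geomTail (2 * K + 1) θ)) / (2 * K + 2) *
          (h.Lam * x) ^ (2 * K + 2) := by
        rw [mul_pow h.Lam x]; ring
    _ ≤ (n ^ 2 * ((1 + w) ^ 2 * (4 * w) ^ (2 * K) * geomTail K c ^ 2 / (K + 1)) +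
        n ^ 2 * ((1 + w) * (4 * w) ^ (2 * K + 1) * geomTail (2 * K + 1) c)) / (2 * K + 2) *
          (h.Lam * x) ^ (2 * K + 2) := by
        gcongr
        exacts [htail_nonneg _, htail _, mul_nonneg (by positivity) (htail_nonneg _), htail _]
    _ = n ^ 2 * truncationConst K w c * (h.Lam * x) ^ (2 * K + 2) := by
        rw [truncationConst]; ring

theorem eps_le (hstage : IsStageForm K a b) (hx : 0 ≤ x)
    (hβ : beta κ * h.Lam * x < K + 1) :
    h.eps K x ≤ (n * κ) ^ 2 * (beta κ ^ (2 * K + 1) / (K.factorial * (K + 1).factorial)) *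
      (h.Lam * x) ^ (2 * K + 2) := by
  obtain ⟨c, hc1, hc0, hwc, hconst⟩ := exists_truncationConst_le hK hstage
  have hy : 0 ≤ h.Lam * x := mul_nonneg h.Lam_nonneg hx
  have hθ : 4 * trotterWeight K * h.Lam * x ≤ c := by
    rw [mul_assoc] at hβ ⊢
    exact mul_le_of_mul_lt hy (by positivity) hc0 hβ hwc
  calc h.eps K x ≤ n ^ 2 * truncationConst K (trotterWeight K) c * (h.Lam * x) ^ (2 * K + 2) :=
      h.eps_le_truncationConst hK hx hc1 hθ
    _ ≤ n ^ 2 * (κ ^ 2 * beta κ ^ (2 * K + 1) / (K.factorial * (K + 1).factorial)) *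
        (h.Lam * x) ^ (2 * K + 2) := by gcongr
    _ = _ := by ring

theorem eta_le {s : ℕ} (hs : s ≤ K) (hx0 : 0 ≤ x)
    (hx : 4 * trotterWeight K * (h.Lam1 * x) ≤ 1) :
    h.eta K (K + s + 1) x ≤ n * ((1 + trotterWeight K) * (K + 1) * (4 * trotterWeight K) ^ K) *
      (h.Lam1 * x) ^ (K + 1) := by
  have hw := trotterWeight_pos K
  have hΛ := h.Lam1_nonneg
  have hs' : ((K : ℝ) + s + 2) / 2 ≤ K + 1 := by
    have : (s : ℝ) ≤ K := by exact_mod_cast hs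
    linarith
  have hC := h.pauliNorm_C_le hK (K + s)
  set w := trotterWeight K
  rw [eta, Nat.add_sub_cancel]
  calc pauliNorm (h.C K (K + s)) * (x ^ (K + s + 1) / (K + s + 1).factorial)
      ≤ n * (1 + w) * h.Lam1 * (4 * w * h.Lam1) ^ (K + s) * ((K + s + 2).factorial / 2) *
        (x ^ (K + s + 1) / (K + s + 1).factorial) := by gcongr
    _ = n * ((1 + w) * ((K + s + 2) / 2) * (4 * w) ^ K) * (h.Lam1 * x) ^ (K + 1) *
        (4 * w * (h.Lam1 * x)) ^ s := by
      rw [Nat.factorial_succ (K + s + 1)]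
      push_cast
      field_simp
      ring
    _ ≤ n * ((1 + w) * (K + 1) * (4 * w) ^ K) * (h.Lam1 * x) ^ (K + 1) * 1 := by
      gcongr
      exact pow_le_one₀ (by positivity) hx
    _ = n * ((1 + w) * (K + 1) * (4 * w) ^ K) * (h.Lam1 * x) ^ (K + 1) := mul_one _

theorem etaSum_le (hstage : IsStageForm K a b) (hx : 0 ≤ x)
    (hβ : beta κ * h.Lam1 * x < K + 2) :
    h.etaSum K x ≤ n * (κ * beta κ ^ (K + 1) / K.factorial) * (h.Lam1 * x) ^ (K + 1) := by
  have hy : 0 ≤ h.Lam1 * x := mul_nonneg h.Lam1_nonneg hx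
  rw [mul_assoc] at hβ
  have hθ : 4 * trotterWeight K * (h.Lam1 * x) ≤ 1 :=
    mul_le_of_mul_lt hy (by positivity) zero_le_one hβ
      ((four_mul_trotterWeight_mul_le_beta hK hstage).trans_eq (one_mul _).symm)
  have heta : ∀ s ∈ Finset.Icc (K + 1) (2 * K + 1), h.eta K s x ≤
      n * ((1 + trotterWeight K) * (K + 1) * (4 * trotterWeight K) ^ K) *
        (h.Lam1 * x) ^ (K + 1) := fun s hs => by
    obtain ⟨hs_low, hs_high⟩ := Finset.mem_Icc.1 hs
    obtain ⟨s, rfl⟩ := Nat.exists_eq_add_of_le hs_low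
    rw [add_right_comm]
    exact h.eta_le hK (by omega) hx hθ
  have hcard : (Finset.Icc (K + 1) (2 * K + 1)).card = K + 1 := by rw [Nat.card_Icc]; omega
  calc h.etaSum K x ≤ _ := Finset.sum_le_card_nsmul _ _ _ heta
    _ = n * ((1 + trotterWeight K) * (K + 1) ^ 2 * (4 * trotterWeight K) ^ K) *
        (h.Lam1 * x) ^ (K + 1) := by
      rw [hcard, nsmul_eq_mul]; push_cast; ring
    _ ≤ n * (κ * beta κ ^ (K + 1) / K.factorial) * (h.Lam1 * x) ^ (K + 1) := by
      gcongr; exact etaSum_const_le_beta hK hstage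

theorem mu_le (hstage : IsStageForm K a b) (hx : 0 ≤ x) (hβ : beta κ * h.Lam1 * x < K + 2) :
    h.mu K x ≤ Real.exp (n ^ 2 * κ ^ 2 * beta κ ^ (2 * K + 2) / (2 * K.factorial ^ 2) *
      (h.Lam1 * x) ^ (2 * K + 2)) := by
  have hη_sq := pow_le_pow_left₀ (h.etaSum_nonneg hx) (h.etaSum_le hK hstage hx hβ) 2
  refine (sqrt_one_add_sq_le_exp _).trans (Real.exp_le_exp.2 ?_)
  calc h.etaSum K x ^ 2 / 2
      ≤ (n * (κ * beta κ ^ (K + 1) / K.factorial) * (h.Lam1 * x) ^ (K + 1)) ^ 2 / 2 := by gcongr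
    _ = n ^ 2 * κ ^ 2 * beta κ ^ (2 * K + 2) / (2 * K.factorial ^ 2) *
        (h.Lam1 * x) ^ (2 * K + 2) := by
      field_simp
      ring

end LatticeHamiltonian

/-! ### The paired formula -/

theorem expI_neg_of_mul_self_eq_one {𝒜 : Type*} [NormedRing 𝒜] [NormedAlgebra ℂ 𝒜]
    [CompleteSpace 𝒜] {P : 𝒜} (hP : P * P = 1) (z : ℂ) :
    expI P (-z) = Complex.cos z • (1 : 𝒜) + (Complex.I * Complex.sin z) • P := by
  set rotation : ℂ → 𝒜 := fun z => Complex.cos z • (1 : 𝒜) + (Complex.I * Complex.sin z) • P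
    with rotation_def
  have hrotation (z : ℂ) : HasDerivAt rotation ((Complex.I • P) * rotation z) z := by
    refine (((Complex.hasDerivAt_cos z).smul_const (1 : 𝒜)).add
      (((Complex.hasDerivAt_sin z).const_mul Complex.I).smul_const P)).congr_deriv ?_
    simp only [rotation_def, mul_add, smul_mul_smul_comm, mul_one, hP, ← mul_assoc,
      Complex.I_mul_I]
    module
  have hproduct (z : ℂ) : HasDerivAt (fun z => expI P z * rotation z) 0 z := by
    refine ((hasDerivAt_expI P z).mul (hrotation z)).congr_deriv ?_
    rw [mul_assoc, ← mul_add, ← add_mul, neg_smul, neg_add_cancel, zero_mul, mul_zero]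
  have hconst : expI P z * rotation z = 1 :=
    (is_const_of_deriv_eq_zero (fun z => (hproduct z).differentiableAt)
      (fun z => (hproduct z).deriv) z 0).trans <| by
        simp [rotation_def, expI_zero]
  calc expI P (-z) = expI P (-z) * (expI P z * rotation z) := by rw [hconst, mul_one]
    _ = rotation z := by rw [← mul_assoc, expI_neg_mul, one_mul]

theorem IsLCUFormula.mul_right {m ι : Type} [Fintype m] [DecidableEq m] [Fintype ι] {μ ε : ℝ}
    {p : ι → ℝ} {W : ι → Matrix m m ℂ} {V S : Matrix m m ℂ} (hV : IsLCUFormula μ ε p W V)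
    (hS : S ∈ Matrix.unitaryGroup m ℂ) : IsLCUFormula μ ε p (fun i => W i * S) (V * S) where
  mu_pos := hV.mu_pos
  prob_nonneg := hV.prob_nonneg
  prob_sum := hV.prob_sum
  unitary i := mul_mem (hV.unitary i) hS
  dist_le := by
    simp only [← smul_mul_assoc, ← Finset.sum_mul, ← sub_mul]
    exact (CStarRing.norm_mul_mem_unitary _ hS).trans_le hV.dist_le

namespace LatticeHamiltonian

variable {n N : ℕ} (h : LatticeHamiltonian n N) (K : ℕ)

theorem signedPauli_mul_self (s : ℕ) (p : PauliString N) :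
    h.signedPauli K s p * h.signedPauli K s p = 1 := by
  rw [signedPauli]
  split_ifs
  · exact pauliOp_mul_self p
  · rw [neg_mul_neg, pauliOp_mul_self]

theorem isHermitian_signedPauli (s : ℕ) (p : PauliString N) :
    (h.signedPauli K s p).IsHermitian := by
  rw [signedPauli]
  split_ifs
  · exact conjTranspose_pauliOp p
  · rw [Matrix.IsHermitian, Matrix.conjTranspose_neg, conjTranspose_pauliOp]

theorem pairedUnitary_eq_expI (x : ℝ) (i : PairIndex N K) :
    h.pairedUnitary K x i =
      expI (h.signedPauli K (i.1 - 1) i.2) (-Real.arctan (h.etaSum K x) : ℝ) := by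
  rw [pairedUnitary, expI]
  congr 2
  push_cast
  ring

theorem pairedUnitary_mem_unitaryGroup (x : ℝ) (i : PairIndex N K) :
    h.pairedUnitary K x i ∈ Matrix.unitaryGroup (Qubits N) ℂ := by
  rw [pairedUnitary_eq_expI]
  exact expI_mem_unitaryGroup (h.isHermitian_signedPauli K _ _) _

theorem mu_pos (x : ℝ) : 0 < h.mu K x := Real.sqrt_pos.2 (by positivity)

theorem mu_smul_pairedUnitary (x : ℝ) (i : PairIndex N K) :
    (h.mu K x : ℂ) • h.pairedUnitary K x i =
      1 + (Complex.I * h.etaSum K x) • h.signedPauli K (i.1 - 1) i.2 := by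
  have hμ : (h.mu K x : ℂ) ≠ 0 := by exact_mod_cast (h.mu_pos K x).ne'
  rw [pairedUnitary_eq_expI, Complex.ofReal_neg,
    expI_neg_of_mul_self_eq_one (h.signedPauli_mul_self K _ _), ← Complex.ofReal_cos,
    ← Complex.ofReal_sin, Real.cos_arctan, Real.sin_arctan, ← mu, smul_add, smul_smul, smul_smul,
    Complex.ofReal_div, Complex.ofReal_div, Complex.ofReal_one, mul_one_div_cancel hμ, one_smul,
    mul_left_comm, mul_div_cancel₀ _ hμ]

theorem abs_coeffC (s : ℕ) (p : PauliString N) :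
    |h.coeffC K s p| = ‖pauliCoeff (h.C K s) p‖ := by
  rw [pauliCoeff_eq_I_mul_im (h.conjTranspose_C K s) p, norm_mul, Complex.norm_I, one_mul,
    Complex.norm_real, Real.norm_eq_abs, coeffC]

theorem abs_coeffC_smul_signedPauli (s : ℕ) (p : PauliString N) :
    ((|h.coeffC K s p| : ℝ) : ℂ) • h.signedPauli K s p = (h.coeffC K s p : ℂ) • pauliOp p := by
  rw [signedPauli]
  split_ifs with hsign
  · rw [abs_of_nonneg hsign]
  · rw [abs_of_neg (not_le.1 hsign), Complex.ofReal_neg, neg_smul_neg]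

theorem pauliNorm_mul_probC (s : ℕ) (p : PauliString N) :
    pauliNorm (h.C K s) * h.probC K s p = |h.coeffC K s p| := by
  rw [probC]
  refine mul_div_cancel_of_imp' fun hC => ?_
  rw [abs_coeffC, pauliCoeff_eq_zero_of_pauliNorm_eq_zero hC, norm_zero]

theorem sum_probC_smul_signedPauli (s : ℕ) :
    (Complex.I * pauliNorm (h.C K s)) • ∑ p, (h.probC K s p : ℂ) • h.signedPauli K s p =
      h.C K s := by
  conv_rhs => rw [← sum_pauliCoeff_smul_pauliOp (h.C K s)]
  rw [Finset.smul_sum]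
  refine Finset.sum_congr rfl fun p _ => ?_
  rw [smul_smul, mul_assoc, ← Complex.ofReal_mul, pauliNorm_mul_probC, mul_smul,
    abs_coeffC_smul_signedPauli, smul_smul, coeffC,
    ← pauliCoeff_eq_I_mul_im (h.conjTranspose_C K s)]

theorem eta_mul_sum_probC (s : ℕ) (x : ℝ) :
    h.eta K s x * ∑ p, h.probC K (s - 1) p = h.eta K s x := by
  rw [eta, mul_right_comm, Finset.mul_sum]
  simp only [pauliNorm_mul_probC, abs_coeffC]
  rw [pauliNorm]

theorem eta_smul_sum_signedPauli (s : ℕ) (x : ℝ) :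
    (Complex.I * h.eta K s x) •
      ∑ p, (h.probC K (s - 1) p : ℂ) • h.signedPauli K (s - 1) p = h.F K s x := by
  rw [F]
  conv_rhs => rw [← h.sum_probC_smul_signedPauli K (s - 1)]
  rw [smul_smul, eta, Complex.ofReal_mul]
  congr 1
  ring

theorem pairedProb_nonneg {x : ℝ} (hx : 0 ≤ x) (i : PairIndex N K) : 0 ≤ h.pairedProb K x i := by
  rw [pairedProb]
  split_ifs
  · positivity
  · exact mul_nonneg (div_nonneg (h.eta_nonneg _ hx) (h.etaSum_nonneg hx))
      (div_nonneg (abs_nonneg _) (pauliNorm_nonneg _))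

theorem sum_pairIndex {M : Type*} [AddCommMonoid M] (f : ℕ → PauliString N → M) :
    ∑ i : PairIndex N K, f i.1 i.2 = ∑ s ∈ Finset.Icc (K + 1) (2 * K + 1), ∑ p, f s p := by
  rw [Fintype.sum_prod_type, ← Finset.sum_coe_sort (Finset.Icc (K + 1) (2 * K + 1))]

theorem sum_pairedProb (x : ℝ) : ∑ i, h.pairedProb K x i = 1 := by
  by_cases hη : h.etaSum K x = 0
  · have : Nonempty (PairIndex N K) := ⟨⟨K + 1, Finset.mem_Icc.2 (by omega)⟩, fun _ => 0⟩
    simp only [pairedProb, if_pos hη, Finset.sum_const, nsmul_eq_mul, Finset.card_univ]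
    exact mul_one_div_cancel (by exact_mod_cast Fintype.card_ne_zero)
  · simp only [pairedProb, if_neg hη]
    rw [sum_pairIndex K fun s p => h.eta K s x / h.etaSum K x * h.probC K (s - 1) p]
    simp only [div_mul_eq_mul_div, ← Finset.sum_div, ← Finset.mul_sum, eta_mul_sum_probC]
    exact div_self hη

theorem etaSum_mul_pairedProb {x : ℝ} (hx : 0 ≤ x) (i : PairIndex N K) :
    h.etaSum K x * h.pairedProb K x i = h.eta K i.1 x * h.probC K (i.1 - 1) i.2 := by
  rw [pairedProb]
  split_ifs with hη
  · have heta := (Finset.sum_eq_zero_iff_of_nonneg fun s _ => h.eta_nonneg s hx).1 hη _ i.1.2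
    rw [hη, heta, zero_mul, zero_mul]
  · rw [← mul_assoc, mul_div_cancel₀ _ hη]

theorem sum_pairedProb_smul_signedPauli {x : ℝ} (hx : 0 ≤ x) :
    ∑ i, (h.pairedProb K x i : ℂ) •
        ((Complex.I * h.etaSum K x) • h.signedPauli K (i.1 - 1) i.2) =
      ∑ s ∈ Finset.Icc (K + 1) (2 * K + 1), h.F K s x := by
  have hterm (i : PairIndex N K) : (h.pairedProb K x i : ℂ) •
      ((Complex.I * h.etaSum K x) • h.signedPauli K (i.1 - 1) i.2) =
        (Complex.I * h.eta K i.1 x) •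
          (h.probC K (i.1 - 1) i.2 : ℂ) • h.signedPauli K (i.1 - 1) i.2 := by
    rw [smul_smul, smul_smul, mul_comm, mul_assoc, mul_assoc, ← Complex.ofReal_mul,
      ← Complex.ofReal_mul, h.etaSum_mul_pairedProb K hx]
  simp only [hterm]
  rw [sum_pairIndex K fun s p => (Complex.I * h.eta K s x) •
    (h.probC K (s - 1) p : ℂ) • h.signedPauli K (s - 1) p]
  simp only [← Finset.smul_sum, eta_smul_sum_signedPauli]

theorem mu_smul_sum_pairedUnitary {x : ℝ} (hx : 0 ≤ x) :
    (h.mu K x : ℂ) • ∑ i, (h.pairedProb K x i : ℂ) • h.pairedUnitary K x i = h.Vtilde K x := by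
  have hterm (i : PairIndex N K) :
      (h.mu K x : ℂ) • (h.pairedProb K x i : ℂ) • h.pairedUnitary K x i =
        (h.pairedProb K x i : ℂ) • (1 : Op N) + (h.pairedProb K x i : ℂ) •
          ((Complex.I * h.etaSum K x) • h.signedPauli K (i.1 - 1) i.2) := by
    rw [smul_comm, mu_smul_pairedUnitary, smul_add]
  simp only [Finset.smul_sum, hterm, Finset.sum_add_distrib]
  rw [h.sum_pairedProb_smul_signedPauli K hx, Vtilde, ← Finset.sum_smul, ← Complex.ofReal_sum,
    sum_pairedProb, Complex.ofReal_one, one_smul]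

theorem isLCUFormula_V {x : ℝ} (hx : 0 ≤ x) : IsLCUFormula (h.mu K x) (h.eps K x)
    (h.pairedProb K x) (h.pairedUnitary K x) (h.V K x) where
  mu_pos := h.mu_pos K x
  prob_nonneg := h.pairedProb_nonneg K hx
  prob_sum := h.sum_pairedProb K x
  unitary := h.pairedUnitary_mem_unitaryGroup K x
  dist_le := by rw [h.mu_smul_sum_pairedUnitary K hx, norm_sub_rev, eps]

theorem V_mul_S (x : ℝ) : h.V K x * h.S K x = h.U x := by
  rw [V, mul_assoc, conjTranspose_S, S_eq_layers, layersInv_mul_layers, mul_one]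

theorem isLCUFormula_U {x : ℝ} (hx : 0 ≤ x) : IsLCUFormula (h.mu K x) (h.eps K x)
    (h.pairedProb K x) (fun i => h.pairedUnitary K x i * h.S K x) (h.U x) :=
  h.V_mul_S K x ▸ (h.isLCUFormula_V K hx).mul_right (h.S_mem_unitaryGroup K x)

end LatticeHamiltonian

end TrotterLCU

end

theorem mainTheorem3 (n N : ℕ) (hn : 0 < n) (h : TrotterLCU.LatticeHamiltonian n N)
    (K : ℕ) (hK : K = 1 ∨ ∃ k : ℕ, 1 ≤ k ∧ K = 2 * k)
    (κ : ℕ) (a b : Fin κ → ℝ) (hstage : TrotterLCU.IsStageForm K a b)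
    (β : ℝ) (hβ : β = 2 * (4 * (κ : ℝ) + 5))
    (x : ℝ) (hx : 0 < x)
    (hx0 : β * h.Lam * x < (K : ℝ) + 1) (hx1 : β * h.Lam1 * x < (K : ℝ) + 2) :
    ((h.mu K x : ℂ) • ∑ i, (h.pairedProb K x i : ℂ) • h.pairedUnitary K x i = h.Vtilde K x) ∧
    TrotterLCU.IsLCUFormula (h.mu K x) (h.eps K x)
      (h.pairedProb K x) (h.pairedUnitary K x) (h.V K x) ∧
    TrotterLCU.IsLCUFormula (h.mu K x) (h.eps K x)
      (h.pairedProb K x) (fun i => h.pairedUnitary K x i * h.S K x) (h.U x) ∧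
    h.mu K x ≤ Real.exp ((n : ℝ) ^ 2 * (κ : ℝ) ^ 2 * β ^ (2 * K + 2) /
      (2 * (K.factorial : ℝ) ^ 2) * (h.Lam1 * x) ^ (2 * K + 2)) ∧
    h.eps K x ≤ ((n : ℝ) * (κ : ℝ)) ^ 2 *
      (β ^ (2 * K + 1) / ((K.factorial : ℝ) * ((K + 1).factorial : ℝ))) *
      (h.Lam * x) ^ (2 * K + 2) := by
  subst hβ
  exact ⟨h.mu_smul_sum_pairedUnitary K hx.le, h.isLCUFormula_V K hx.le, h.isLCUFormula_U K hx.le,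
    h.mu_le hK hstage hx.le hx1, h.eps_le hK hstage hx.le hx0⟩
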